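/- Fix integers $m\ge 0$ (block size) and $n\ge 0$, and real $m\times m$ matrices $\Sigma_0,\dots,\Sigma_n$. For $m\times m$ blocks $R_0,\dots,R_{N-1}$ let $\mathrm{Toepl}(R_0,\dots,R_{N-1})$ be the matrix with $N\times N$ blocks whose $(i,j)$ block is $R_{j-i}$ for $i\le j$ and $R_{i-j}^\top$ for $i>j$ (so it is the symmetric block-Toeplitz matrix with first block row $R_0,\dots,R_{N-1}$ when $R_0$ is symmetric). Let $\mathbf T_n=\mathrm{Toepl}(\Sigma_0,\Sigma_1^\top,\dots,\Sigma_n^\top)$ (with $\Sigma_0=\Sigma_0^\top$) and assume that $\mathbf T_n$ is positive definite. Let $E_n=\begin{bmatrix} I_{m(n+1)}\\ 0\end{bmatrix}$ with $N\times(n+1)$ blocks, let $\mathbf U_N$ be the block-circulant shift with $N\times N$ blocks (identity blocks at the positions $(i,i+1 \bmod N)$), and let $\mathbf A_{N-1}=[\,I\;\;0\,]$, $\mathbf B_{N-1}=[\,0\;\;I\,]$ with $(N-1)\times N$ blocks. TME problem of size $N$: maximize $\log\det\mathbf\Sigma$ over real symmetric positive definite $\mathbf\Sigma$ with $N\times N$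 blocks of size $m\times m$ such that $E_n^\top\mathbf\Sigma E_n=\mathbf T_n$ and $\mathbf A_{N-1}\mathbf\Sigma\mathbf A_{N-1}^\top=\mathbf B_{N-1}\mathbf\Sigma\mathbf B_{N-1}^\top$ (i.e. $\mathbf\Sigma$ is block-Toeplitz). CME problem of size $N$: maximize $\log\det\mathbf\Sigma$ over real symmetric positive definite $\mathbf\Sigma$ with $N\times N$ blocks of size $m\times m$ such that $E_n^\top\mathbf\Sigma E_n=\mathbf T_n$ and $\mathbf U_N^\top\mathbf\Sigma\mathbf U_N=\mathbf\Sigma$ (i.e. $\mathbf\Sigma$ is block-circulant). There is exactly one sequence $(\hat\Sigma_k)_{k\ge0}$, the maximum entropy block-Toeplitz extension of the data, such that for every $N\ge n+1$ the matrix $\mathrm{Toepl}(\hat\Sigma_0,\hat\Sigma_1^\top,\dots,\hat\Sigma_{N-1}^\top)$ solves the TME problem of size $N$; in particular $\hat\Sigma_k=\Sigma_k$ for $k\le n$. Define $$\mathbf\Sigma_N^{(c)}=\mathrm{Toepl}\bigl(\hat\Sigma_0,\hat\Sigma_1^\top,\dots,\hat\Sigma_{N/2-1}^\top,\ \hat\Sigma_{N/2}^\top+\hat\Sigma_{N/2},\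 \hat\Sigma_{N/2-1},\dots,\hat\Sigma_1\bigr)\quad(N\text{ even}),$$ $$\mathbf\Sigma_N^{(c)}=\mathrm{Toepl}\bigl(\hat\Sigma_0,\hat\Sigma_1^\top,\dots,\hat\Sigma_{(N-1)/2}^\top,\ \hat\Sigma_{(N-1)/2},\dots,\hat\Sigma_1\bigr)\quad(N\text{ odd}).$$ Then for all sufficiently large $N$: $\mathbf\Sigma_N^{(c)}$ is a symmetric positive definite block-circulant matrix with $E_n^\top\mathbf\Sigma_N^{(c)}E_n=\mathbf T_n$; the CME problem of size $N$ has exactly one solution $\mathbf\Sigma_N^{o}$; and $(\mathbf\Sigma_N^{o})^{-1}$ is banded block-circulant of bandwidth $n$, i.e. it is block-circulant and its $(i,j)$ block vanishes whenever $(i-j)\bmod N>n$ and $(j-i)\bmod N>n$. Moreover, in the Frobenius norm (hence also in the spectral norm), $$\lim_{N\to\infty}\bigl\|\mathbf\Sigma_N^{(c)}-\mathbf\Sigma_N^{o}\bigr\|=0\qquad\text{and}\qquad \lim_{N\to\infty}\bigl\|(\mathbf\Sigma_N^{(c)})^{-1}-(\mathbf\Sigma_N^{o})^{-1}\bigr\|=0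 .$$ -/

import Mathlib

open Filter Topology
open scoped Matrix

/-- `m × m` real matrices: the blocks. -/
abbrev Blk (m : ℕ) := Matrix (Fin m) (Fin m) ℝ

/-- Real matrices with `p × q` blocks, each of dimension `m × m`; the entry at `((i, a), (j, b))` is
the `(a, b)` entry of the `(i, j)` block. -/
abbrev BlockMat (p q m : ℕ) := Matrix (Fin p × Fin m) (Fin q × Fin m) ℝ

/-- The block matrix with given blocks. -/
def ofBlocks {p q m : ℕ} (F : Fin p → Fin q → Blk m) : BlockMat p q m :=
  Matrix.of fun x y => F x.1 y.1 x.2 y.2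

/-- The `(i, j)` block of a block matrix. -/
def blockAt {p q m : ℕ} (C : BlockMat p q m) (i : Fin p) (j : Fin q) : Blk m :=
  Matrix.of fun a b => C (i, a) (j, b)

/-- `Toepl (R 0, …, R (N - 1))`: the symmetric block-Toeplitz matrix with first block row
`R 0, …, R (N - 1)`. -/
def toepl {N m : ℕ} (R : Fin N → Blk m) : BlockMat N N m :=
  ofBlocks fun i j =>
    if i ≤ j then R ⟨j.1 - i.1, by omega⟩ else (R ⟨i.1 - j.1, by omega⟩)ᵀ

/-- The block-Toeplitz data matrix `T_n = Toepl (Σ₀, Σ₁ᵀ, …, Σ_nᵀ)`. -/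
def dataToepl {n m : ℕ} (S : Fin (n + 1) → Blk m) : BlockMat (n + 1) (n + 1) m :=
  toepl fun k => (S k)ᵀ

/-- The `N × (n + 1)` block matrix `E_n`: identity block on top, zeros below. -/
def blockE (N n m : ℕ) : BlockMat N (n + 1) m :=
  ofBlocks fun i j => if i.1 = j.1 then 1 else 0

/-- The block-circulant shift `U_N` with `N × N` blocks. -/
def blockU (N m : ℕ) : BlockMat N N m :=
  ofBlocks fun i j => if j.1 = (i.1 + 1) % N then 1 else 0

/-- The `(N - 1) × N` block shift matrix `A_{N-1} = [I 0]`. -/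
def blockA (N m : ℕ) : BlockMat (N - 1) N m :=
  ofBlocks fun i j => if j.1 = i.1 then 1 else 0

/-- The `(N - 1) × N` block shift matrix `B_{N-1} = [0 I]`. -/
def blockB (N m : ℕ) : BlockMat (N - 1) N m :=
  ofBlocks fun i j => if j.1 = i.1 + 1 then 1 else 0

/-- A matrix with `N × N` blocks is block-circulant: it is invariant under the block shift. -/
def IsBlockCirculant {N m : ℕ} (C : BlockMat N N m) : Prop :=
  (blockU N m)ᵀ * C * blockU N m = C

/-- The positive definite (in particular symmetric) block-Toeplitz extensions of the data, with
`N × N` blocks: the feasible set of the Toeplitz maximum entropy problem. -/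
def toeplitzExtensions {n m : ℕ} (S : Fin (n + 1) → Blk m) (N : ℕ) : Set (BlockMat N N m) :=
  {C | C.PosDef ∧ (blockE N n m)ᵀ * C * blockE N n m = dataToepl S ∧
    blockA N m * C * (blockA N m)ᵀ = blockB N m * C * (blockB N m)ᵀ}

/-- The positive definite (in particular symmetric) block-circulant extensions of the data, with
`N × N` blocks: the feasible set of the circulant maximum entropy problem. -/
def circulantExtensions {n m : ℕ} (S : Fin (n + 1) → Blk m) (N : ℕ) : Set (BlockMat N N m) :=
  {C | C.PosDef ∧ (blockE N n m)ᵀ * C * blockE N n m = dataToepl S ∧ IsBlockCirculant C}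

/-- `C` solves the maximum entropy block-Toeplitz extension problem (TME) with `N × N` blocks. -/
def SolvesTME {n m : ℕ} (S : Fin (n + 1) → Blk m) (N : ℕ) (C : BlockMat N N m) : Prop :=
  C ∈ toeplitzExtensions S N ∧
    IsMaxOn (fun X : BlockMat N N m => Real.log X.det) (toeplitzExtensions S N) C

/-- `C` solves the maximum entropy block-circulant extension problem (CME) with `N × N` blocks. -/
def SolvesCME {n m : ℕ} (S : Fin (n + 1) → Blk m) (N : ℕ) (C : BlockMat N N m) : Prop :=
  C ∈ circulantExtensions S N ∧
    IsMaxOn (fun X : BlockMat N N m => Real.log X.det) (circulantExtensions S N) C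

/-- The sequence `Shat 0, Shat 1, …` is the maximum entropy block-Toeplitz extension of the data:
for every `N ≥ n + 1` the matrix `Toepl (Shat 0, (Shat 1)ᵀ, …, (Shat (N - 1))ᵀ)` solves the TME
problem with `N × N` blocks. (For `N = n + 1` this forces `Shat k = S k` for `k ≤ n`.) -/
def IsMaxEntToeplitzExtension {n m : ℕ} (S : Fin (n + 1) → Blk m) (Shat : ℕ → Blk m) : Prop :=
  ∀ N : ℕ, n + 1 ≤ N → SolvesTME S N (toepl fun k : Fin N => (Shat k.1)ᵀ)

/-- The wrapped matrix: the symmetric block-Toeplitz matrix with first block row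
`Shat 0, (Shat 1)ᵀ, …, (Shat (N/2 - 1))ᵀ, (Shat (N/2))ᵀ + Shat (N/2), Shat (N/2 - 1), …, Shat 1`
for `N` even and
`Shat 0, (Shat 1)ᵀ, …, (Shat ((N-1)/2))ᵀ, Shat ((N-1)/2), …, Shat 1` for `N` odd. -/
def wrapped {m : ℕ} (Shat : ℕ → Blk m) (N : ℕ) : BlockMat N N m :=
  toepl fun k : Fin N =>
    if 2 * k.1 < N then (Shat k.1)ᵀ
    else if 2 * k.1 = N then (Shat k.1)ᵀ + Shat k.1
    else Shat (N - k.1)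

/-- `C` is banded block-circulant of bandwidth `n`: block-circulant, with zero `(i, j)` block
whenever the circular distance of `i` and `j` exceeds `n` (subtraction in `Fin N` is modulo `N`). -/
def IsBandedBlockCirculant {N m : ℕ} (n : ℕ) (C : BlockMat N N m) : Prop :=
  IsBlockCirculant C ∧
    ∀ i j : Fin N, n < (i - j).1 → n < (j - i).1 → blockAt C i j = 0

-- Matrix norms below are Frobenius norms, which dominate the spectral norms.
attribute [local instance] Matrix.frobeniusNormedAddCommGroup

/-! The maximum entropy extension is the covariance sequence of a stationary autoregressive process
of order n. Its coefficients are the last block row of the inverse of T_n, normalized to start with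
the identity, and the Yule-Walker recursion continues the data (`exists_isAutoregressive`). Each
larger Toeplitz matrix borders the previous one with Schur complement Λ, so all of them are positive
definite with inverses of bandwidth n (`posDef_toeplZ_and_banded`). A banded inverse is orthogonal
to every difference of two extensions, and concavity of log det turns this into optimality
(`solvesTME_of_banded_inv`).

A Lyapunov argument on the companion matrix shows that the covariances decay exponentially
(`exists_geometric_bound`). Let L be the circulant matrix of the autoregressive filter and W the
wrapped matrix. On the full line, filtering whitens the covariance exactly; wrapping changes it only
at lags near or beyond N/2. So L W Lᵀ is block-diagonal with blocks Λ, up to an exponentially small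
error. Hence W is positive definite for large N, and its inverse is exponentially close to the
banded matrix B = Lᵀ Λ⁻¹ L (`exists_wrapped_bounds`).

A circulant optimum O exists by compactness, and stationarity makes its inverse banded. Since W - O
vanishes in the band and O⁻¹ - B vanishes outside it, tr((W - O)(O⁻¹ - W⁻¹)) equals tr((W - O)(B -
W⁻¹)), which is at most ‖W - O‖ ‖W⁻¹ - B‖. The quantitative monotonicity of inversion
(`PosDef.norm_sub_sq_le`) bounds ‖W - O‖² by this pairing times tr O · tr W, a factor that is
quadratic in N. All losses are polynomial in N and the gain is exponential, so ‖W - O‖ tends to 0;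
the bound on W⁻¹ then carries the convergence over to the inverses. -/

namespace Matrix

theorem PosDef.isSymm {ι : Type*} {A : Matrix ι ι ℝ} (hA : A.PosDef) : Aᵀ = A :=
  (by simpa using hA.isHermitian : A.IsSymm)

variable {ι κ : Type*} [Fintype ι] [Fintype κ]

/-! ### The Frobenius norm -/

theorem frobenius_norm_sq (A : Matrix ι κ ℝ) : ‖A‖ ^ 2 = ∑ i, ∑ j, A i j ^ 2 := by
  rw [frobenius_norm_def, ← Real.sqrt_eq_rpow, Real.sq_sqrt (by positivity)]
  simp

theorem trace_mul_transpose_eq_sum (A B : Matrix ι κ ℝ) :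
    (A * Bᵀ).trace = ∑ i, ∑ j, A i j * B i j := by
  simp [trace, mul_apply]

theorem frobenius_norm_sq_eq_trace (A : Matrix ι κ ℝ) : ‖A‖ ^ 2 = (A * Aᵀ).trace := by
  rw [frobenius_norm_sq, trace_mul_transpose_eq_sum]
  simp [sq]

theorem abs_trace_mul_le (A : Matrix ι κ ℝ) (B : Matrix κ ι ℝ) :
    |(A * B).trace| ≤ ‖A‖ * ‖B‖ := by
  have h := trace_mul_transpose_eq_sum A Bᵀ
  rw [transpose_transpose] at h
  rw [h, ← frobenius_norm_transpose B]
  apply abs_le_of_sq_le_sq _ (by positivity)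
  rw [mul_pow, frobenius_norm_sq, frobenius_norm_sq]
  simp only [← Fintype.sum_prod_type']
  exact Finset.sum_mul_sq_le_sq_mul_sq _ (fun x : ι × κ => A x.1 x.2) fun x => Bᵀ x.1 x.2

theorem abs_entry_le_frobenius (A : Matrix ι κ ℝ) (i : ι) (j : κ) : |A i j| ≤ ‖A‖ := by
  apply abs_le_of_sq_le_sq _ (norm_nonneg _)
  rw [frobenius_norm_sq]
  calc A i j ^ 2 ≤ ∑ j, A i j ^ 2 :=
        Finset.single_le_sum (f := fun j => A i j ^ 2) (fun _ _ => sq_nonneg _) (Finset.mem_univ j)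
    _ ≤ _ := Finset.single_le_sum (f := fun i => ∑ j, A i j ^ 2)
        (fun _ _ => Finset.sum_nonneg fun _ _ => sq_nonneg _) (Finset.mem_univ i)

theorem frobenius_le_sum_abs (A : Matrix ι κ ℝ) : ‖A‖ ≤ ∑ i, ∑ j, |A i j| := by
  have h0 : 0 ≤ ∑ i, ∑ j, |A i j| := by positivity
  rw [← abs_of_nonneg (norm_nonneg A), ← abs_of_nonneg h0, ← sq_le_sq, frobenius_norm_sq]
  simp only [← Fintype.sum_prod_type']
  have := Finset.sum_sq_le_sq_sum_of_nonneg (s := Finset.univ) (f := fun x : ι × κ => |A x.1 x.2|)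
    (fun _ _ => abs_nonneg _)
  simpa using this

/-! ### Positive definite matrices -/

variable [DecidableEq ι]

theorem PosSemidef.exists_mul_transpose {A : Matrix ι ι ℝ} (hA : A.PosSemidef) :
    ∃ M : Matrix ι ι ℝ, A = M * Mᵀ := by
  open scoped MatrixOrder in
  obtain ⟨B, hB⟩ := CStarAlgebra.nonneg_iff_eq_star_mul_self.mp hA.nonneg
  exact ⟨Bᵀ, by simpa [star_eq_conjTranspose] using hB⟩

theorem PosSemidef.frobenius_le_trace {A : Matrix ι ι ℝ} (hA : A.PosSemidef) : ‖A‖ ≤ A.trace := by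
  obtain ⟨M, rfl⟩ := hA.exists_mul_transpose
  rw [← frobenius_norm_sq_eq_trace, sq]
  exact (frobenius_norm_mul _ _).trans (by rw [frobenius_norm_transpose])

theorem PosDef.exists_mul_transpose {A : Matrix ι ι ℝ} (hA : A.PosDef) :
    ∃ M : Matrix ι ι ℝ, IsUnit M.det ∧ A = M * Mᵀ := by
  obtain ⟨M, rfl⟩ := hA.posSemidef.exists_mul_transpose
  refine ⟨M, ?_, rfl⟩
  have := hA.det_pos
  rw [det_mul, det_transpose] at this
  exact isUnit_iff_ne_zero.mpr fun h => by simp [h] at this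

theorem PosDef.isUnit_det {A : Matrix ι ι ℝ} (hA : A.PosDef) : IsUnit A.det :=
  hA.det_pos.ne'.isUnit

theorem posDef_mul_mul_transpose_iff {A L : Matrix ι ι ℝ} (hL : IsUnit L.det) :
    (L * A * Lᵀ).PosDef ↔ A.PosDef := by
  simpa [star_eq_conjTranspose] using
    IsUnit.posDef_star_right_conjugate_iff (x := A) ((isUnit_iff_isUnit_det L).mpr hL)

/-- Two positive definite matrices are close as soon as the pairing of their difference with the
difference of their inverses is small. -/
theorem PosDef.norm_sub_sq_le {W O : Matrix ι ι ℝ} (hW : W.PosDef) (hO : O.PosDef) :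
    ‖W - O‖ ^ 2 ≤ O.trace * W.trace * ((W - O) * (O⁻¹ - W⁻¹)).trace := by
  obtain ⟨M, hM, rfl⟩ := hO.exists_mul_transpose
  obtain ⟨K, hK, rfl⟩ := hW.exists_mul_transpose
  have hMt : IsUnit Mᵀ.det := by rwa [det_transpose]
  have hKt : IsUnit Kᵀ.det := by rwa [det_transpose]
  set D := K * Kᵀ - M * Mᵀ with hD
  have hDs : Dᵀ = D := by simp [hD]
  -- Since O⁻¹ - W⁻¹ = O⁻¹ D W⁻¹, the pairing is tr(D O⁻¹ D W⁻¹) = ‖Y‖², while D = M Y Kᵀ with ‖M‖²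
  -- = tr O and ‖K‖² = tr W.
  set Y := M⁻¹ * D * Kᵀ⁻¹ with hY
  have hDY : D = M * Y * Kᵀ := by
    rw [hY, Matrix.mul_assoc M⁻¹, mul_nonsing_inv_cancel_left _ _ hM,
      nonsing_inv_mul_cancel_right _ _ hKt]
  have e1 : (M * Mᵀ)⁻¹ - (K * Kᵀ)⁻¹ = (M * Mᵀ)⁻¹ * D * (K * Kᵀ)⁻¹ := by
    have hMM : IsUnit (M * Mᵀ).det := by rw [det_mul]; exact hM.mul hMt
    have hKK : IsUnit (K * Kᵀ).det := by rw [det_mul]; exact hK.mul hKt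
    rw [hD, Matrix.mul_sub, Matrix.sub_mul, nonsing_inv_mul _ hMM, Matrix.one_mul,
      mul_nonsing_inv_cancel_right _ _ hKK]
  have e2 : (D * ((M * Mᵀ)⁻¹ - (K * Kᵀ)⁻¹)).trace = ‖Y‖ ^ 2 := by
    rw [e1, frobenius_norm_sq_eq_trace, hY]
    simp only [mul_inv_rev, transpose_mul, hDs, transpose_nonsing_inv, transpose_transpose]
    rw [show M⁻¹ * D * Kᵀ⁻¹ * (K⁻¹ * (D * Mᵀ⁻¹)) = M⁻¹ * (D * Kᵀ⁻¹ * K⁻¹ * D * Mᵀ⁻¹) by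
      simp only [Matrix.mul_assoc], trace_mul_comm,
      trace_mul_comm M⁻¹]
    simp only [Matrix.mul_assoc]
    rw [← Matrix.mul_assoc Mᵀ⁻¹, trace_mul_comm (Mᵀ⁻¹ * M⁻¹)]
    simp only [Matrix.mul_assoc]
  rw [e2, ← frobenius_norm_sq_eq_trace, ← frobenius_norm_sq_eq_trace]
  have : ‖D‖ ≤ ‖M‖ * ‖Y‖ * ‖K‖ := by
    rw [hDY, ← frobenius_norm_transpose K]
    refine (frobenius_norm_mul _ _).trans ?_
    gcongr
    exact frobenius_norm_mul _ _
  calc ‖D‖ ^ 2 ≤ (‖M‖ * ‖Y‖ * ‖K‖) ^ 2 := by gcongr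
    _ = _ := by ring

theorem PosDef.eq_of_trace_sub_mul_inv_sub_eq_zero {W O : Matrix ι ι ℝ} (hW : W.PosDef)
    (hO : O.PosDef) (h : ((W - O) * (O⁻¹ - W⁻¹)).trace = 0) : W = O := by
  have := hW.norm_sub_sq_le hO
  rw [h, mul_zero] at this
  exact sub_eq_zero.mp (norm_eq_zero.mp (pow_eq_zero_iff two_ne_zero |>.mp
    (le_antisymm this (sq_nonneg _))))

/-- The resolvent estimate for the inverse of a perturbed matrix. -/
theorem norm_inv_sub_inv_le {P Q : Matrix ι ι ℝ} (hP : IsUnit P.det) (hQ : IsUnit Q.det)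
    {c : ℝ} (hc : ‖P⁻¹‖ ≤ c) (h : c * ‖Q - P‖ ≤ 1 / 2) :
    ‖Q⁻¹ - P⁻¹‖ ≤ 2 * c ^ 2 * ‖Q - P‖ := by
  have e : Q⁻¹ - P⁻¹ = P⁻¹ * (P - Q) * Q⁻¹ := by
    rw [Matrix.mul_sub, Matrix.sub_mul, nonsing_inv_mul _ hP, Matrix.one_mul,
      mul_nonsing_inv_cancel_right _ _ hQ]
  have h0 : 0 ≤ c := (norm_nonneg _).trans hc
  have h1 : ‖Q⁻¹ - P⁻¹‖ ≤ c * ‖Q - P‖ * ‖Q⁻¹‖ := by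
    rw [e, norm_sub_rev Q P]
    refine (frobenius_norm_mul _ _).trans ?_
    gcongr
    exact (frobenius_norm_mul _ _).trans (by gcongr)
  have h2 : ‖Q⁻¹‖ ≤ 2 * c := by
    have h3 : ‖Q⁻¹‖ ≤ ‖Q⁻¹ - P⁻¹‖ + ‖P⁻¹‖ := by
      simpa using norm_add_le (Q⁻¹ - P⁻¹) P⁻¹
    nlinarith [norm_nonneg Q⁻¹]
  calc _ ≤ c * ‖Q - P‖ * ‖Q⁻¹‖ := h1
    _ ≤ c * ‖Q - P‖ * (2 * c) := by gcongr
    _ = _ := by ring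

/-- Cauchy-Schwarz: xᵀ Y x is the trace pairing of Y with x xᵀ, whose Frobenius norm is xᵀ x. -/
theorem posDef_one_add_of_norm_lt {Y : Matrix ι ι ℝ} (hY : Yᵀ = Y) (h : ‖Y‖ < 1) :
    (1 + Y).PosDef := by
  refine .of_dotProduct_mulVec_pos (by simp [IsSymm, hY]) fun x hx => ?_
  have hx2 : 0 < x ⬝ᵥ x := by
    simpa using (dotProduct_star_self_pos_iff (v := x)).mpr hx
  have key : |x ⬝ᵥ (Y *ᵥ x)| ≤ ‖Y‖ * (x ⬝ᵥ x) := by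
    have h1 : (Y * vecMulVec x x).trace = x ⬝ᵥ (Y *ᵥ x) := by
      rw [mul_vecMulVec, trace_vecMulVec, dotProduct_comm]
    have h2 : ‖vecMulVec x x‖ = x ⬝ᵥ x := by
      rw [← sq_eq_sq₀ (norm_nonneg _) hx2.le, frobenius_norm_sq]
      simp only [vecMulVec_apply, dotProduct, sq, Finset.sum_mul_sum]
      refine Finset.sum_congr rfl fun i _ => Finset.sum_congr rfl fun j _ => by ring
    rw [← h1, ← h2]
    exact abs_trace_mul_le _ _
  have := (abs_le.mp key).1
  simp only [star_trivial, add_mulVec, one_mulVec, dotProduct_add]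
  nlinarith

/-- With P = K Kᵀ, write Q = K (1 + Y) Kᵀ. Then ‖Y‖ ≤ ‖K⁻¹‖² ‖Q - P‖, and ‖K⁻¹‖² = tr P⁻¹. -/
theorem PosDef.of_norm_sub_lt {P Q : Matrix ι ι ℝ} (hP : P.PosDef) (hQ : Qᵀ = Q)
    (h : P⁻¹.trace * ‖Q - P‖ < 1) : Q.PosDef := by
  have hPs := hP.isSymm
  obtain ⟨K, hK, rfl⟩ := hP.exists_mul_transpose
  have hKt : IsUnit Kᵀ.det := by rwa [det_transpose]
  set Y := K⁻¹ * (Q - K * Kᵀ) * K⁻¹ᵀ with hY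
  have hYs : Yᵀ = Y := by simp [hY, hQ, transpose_mul, Matrix.mul_assoc]
  have hn : ‖Y‖ < 1 := by
    refine lt_of_le_of_lt ?_ h
    have : (K * Kᵀ)⁻¹.trace = ‖K⁻¹‖ * ‖K⁻¹ᵀ‖ := by
      rw [mul_inv_rev, trace_mul_comm, ← transpose_nonsing_inv, ← frobenius_norm_sq_eq_trace, sq,
        frobenius_norm_transpose]
    rw [this, hY]
    calc _ ≤ ‖K⁻¹ * (Q - K * Kᵀ)‖ * ‖K⁻¹ᵀ‖ := frobenius_norm_mul _ _
      _ ≤ ‖K⁻¹‖ * ‖Q - K * Kᵀ‖ * ‖K⁻¹ᵀ‖ := by gcongr; exact frobenius_norm_mul _ _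
      _ = _ := by ring
  have e : Q = K * (1 + Y) * Kᵀ := by
    rw [Matrix.mul_add, Matrix.add_mul, Matrix.mul_one, hY, transpose_nonsing_inv,
      Matrix.mul_assoc K⁻¹, mul_nonsing_inv_cancel_left _ _ hK,
      nonsing_inv_mul_cancel_right _ _ hKt, add_sub_cancel]
  rw [e]
  exact (posDef_mul_mul_transpose_iff hK).mpr (posDef_one_add_of_norm_lt hYs hn)

/-- The congruence `L W Lᵀ = P + E` with `E` small transfers positivity to `W` and approximates
its inverse by `Lᵀ P⁻¹ L`. -/
theorem PosDef.of_congruence_near {L W P : Matrix ι ι ℝ} (hP : P.PosDef) (hW : Wᵀ = W)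
    {lam c ε : ℝ} (hL : ‖L‖ ≤ lam) (hc : P⁻¹.trace ≤ c) (hε : ‖L * W * Lᵀ - P‖ ≤ ε) (hcε : c * ε ≤ 1 / 2) :
    W.PosDef ∧ ‖W⁻¹ - Lᵀ * P⁻¹ * L‖ ≤ lam ^ 2 * (2 * c ^ 2 * ε) ∧ ‖W⁻¹‖ ≤ lam ^ 2 * (2 * c) := by
  set M := L * W * Lᵀ with hMdef
  have hlam : 0 ≤ lam := (norm_nonneg _).trans hL
  have hc' : ‖P⁻¹‖ ≤ c := hP.inv.posSemidef.frobenius_le_trace.trans hc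
  have hc0 : 0 ≤ c := (norm_nonneg _).trans hc'
  have hcM : c * ‖M - P‖ ≤ 1 / 2 := (mul_le_mul_of_nonneg_left hε hc0).trans hcε
  have hM : M.PosDef := by
    refine hP.of_norm_sub_lt (by simp [hMdef, Matrix.transpose_mul, hW, Matrix.mul_assoc]) ?_
    calc _ ≤ c * ‖M - P‖ := by gcongr
      _ < 1 := by linarith
  -- Invertibility of L is not assumed: it follows from that of L W Lᵀ.
  have hLdet : IsUnit L.det := by
    have := hM.det_pos
    rw [hMdef, Matrix.det_mul, Matrix.det_mul] at this
    exact isUnit_iff_ne_zero.mpr fun h => by simp [h] at this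
  have hLtdet : IsUnit Lᵀ.det := by rwa [Matrix.det_transpose]
  have hinv : W⁻¹ = Lᵀ * M⁻¹ * L := by
    rw [hMdef, Matrix.mul_inv_rev, Matrix.mul_inv_rev, Matrix.mul_nonsing_inv_cancel_left _ _ hLtdet,
      Matrix.nonsing_inv_mul_cancel_right _ _ hLdet]
  have hdiff := Matrix.norm_inv_sub_inv_le hP.isUnit_det hM.isUnit_det hc' hcM
  have hdiff' : ‖M⁻¹ - P⁻¹‖ ≤ 2 * c ^ 2 * ε := hdiff.trans (by gcongr)
  have hconj (X : Matrix ι ι ℝ) : ‖Lᵀ * X * L‖ ≤ lam ^ 2 * ‖X‖ := by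
    calc _ ≤ ‖Lᵀ‖ * ‖X‖ * ‖L‖ := (Matrix.frobenius_norm_mul _ _).trans (by
          gcongr
          exact Matrix.frobenius_norm_mul _ _)
      _ ≤ lam * ‖X‖ * lam := by
          rw [Matrix.frobenius_norm_transpose]
          gcongr
      _ = _ := by ring
  refine ⟨(Matrix.posDef_mul_mul_transpose_iff hLdet).mp hM, ?_, ?_⟩
  · rw [hinv, ← Matrix.sub_mul, ← Matrix.mul_sub]
    exact (hconj _).trans (by gcongr)
  · rw [hinv]
    refine (hconj _).trans ?_
    have : ‖M⁻¹‖ ≤ ‖M⁻¹ - P⁻¹‖ + ‖P⁻¹‖ := by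
      simpa using norm_add_le (M⁻¹ - P⁻¹) P⁻¹
    gcongr
    nlinarith

/-! ### Log-determinant: concavity bound and stationarity -/

theorem PosDef.log_det_le_trace_sub {Z : Matrix ι ι ℝ} (hZ : Z.PosDef) :
    Real.log Z.det ≤ Z.trace - Fintype.card ι := by
  rw [hZ.1.det_eq_prod_eigenvalues, hZ.1.trace_eq_sum_eigenvalues]
  simp only [RCLike.ofReal_real_eq_id, id]
  rw [Real.log_prod fun i _ => (hZ.eigenvalues_pos i).ne']
  calc _ ≤ ∑ i, (hZ.1.eigenvalues i - 1) :=
        Finset.sum_le_sum fun i _ => Real.log_le_sub_one_of_pos (hZ.eigenvalues_pos i)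
    _ = _ := by simp

/-- Whitening by C = M Mᵀ turns X into a matrix of trace tr(C⁻¹ X), which the hypothesis makes equal
to its size; `log_det_le_trace_sub` then bounds its log-determinant by 0. -/
theorem PosDef.log_det_le {C X : Matrix ι ι ℝ} (hC : C.PosDef) (hX : X.PosDef)
    (h : (C⁻¹ * (X - C)).trace = 0) : Real.log X.det ≤ Real.log C.det := by
  obtain ⟨M, hM, rfl⟩ := hC.exists_mul_transpose
  have hMt : IsUnit Mᵀ.det := by rwa [det_transpose]
  have hMi : IsUnit M⁻¹.det := isUnit_nonsing_inv_det _ hM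
  have hZ := (posDef_mul_mul_transpose_iff hMi).mpr hX
  have htr : (M⁻¹ * X * M⁻¹ᵀ).trace = Fintype.card ι := by
    rw [trace_mul_comm, ← Matrix.mul_assoc, transpose_nonsing_inv, ← mul_inv_rev]
    rw [Matrix.mul_sub, trace_sub, nonsing_inv_mul _ hC.isUnit_det, trace_one] at h
    linarith
  have h1 := hZ.log_det_le_trace_sub
  rw [htr, sub_self] at h1
  have hd : X.det = (M * Mᵀ).det * (M⁻¹ * X * M⁻¹ᵀ).det := by
    rw [← det_mul]
    have : (M⁻¹ * X * M⁻¹ᵀ).det = (M⁻¹ᵀ * M⁻¹ * X).det := by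
      rw [det_mul_comm, Matrix.mul_assoc]
    rw [det_mul, this, ← det_mul, transpose_nonsing_inv, ← mul_inv_rev,
      mul_nonsing_inv_cancel_left _ _ hC.isUnit_det]
  rw [hd, Real.log_mul hC.det_pos.ne' hZ.det_pos.ne']
  linarith

theorem PosDef.eventually_add_smul {O D : Matrix ι ι ℝ} (hO : O.PosDef) (hD : Dᵀ = D) :
    ∀ᶠ t in 𝓝 (0 : ℝ), (O + t • D).PosDef := by
  have h : Tendsto (fun t : ℝ => O⁻¹.trace * (|t| * ‖D‖)) (𝓝 0) (𝓝 0) := by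
    have : Continuous fun t : ℝ => O⁻¹.trace * (|t| * ‖D‖) := by fun_prop
    simpa using this.tendsto 0
  filter_upwards [h.eventually_lt_const one_pos] with t ht
  refine hO.of_norm_sub_lt (by simp [hO.isSymm, hD]) ?_
  have : ‖t • D‖ = |t| * ‖D‖ := by
    rw [← sq_eq_sq₀ (norm_nonneg _) (by positivity), frobenius_norm_sq, mul_pow, sq_abs,
      frobenius_norm_sq]
    simp [mul_pow, Finset.mul_sum]
  rwa [add_sub_cancel_left, this]

/-- First-order condition at a local maximum of the determinant along a line. -/
theorem trace_inv_mul_eq_zero_of_forall_det_le {O D : Matrix ι ι ℝ} (hO : O.PosDef)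
    (h : ∀ᶠ t in 𝓝 (0 : ℝ), (O + t • D).det ≤ O.det) : (O⁻¹ * D).trace = 0 := by
  -- The determinant of 1 + t O⁻¹ D is a polynomial in t with constant term 1 and linear coefficient
  -- tr(O⁻¹ D); p collects the terms of order at least 2, divided by t².
  set p := (1 + (Polynomial.X : Polynomial ℝ) • (O⁻¹ * D).map Polynomial.C).det.divX.divX
  have hder : HasDerivAt (fun t : ℝ => 1 + (O⁻¹ * D).trace * t + p.eval t * t ^ 2)
      ((O⁻¹ * D).trace) 0 := by
    have h1 := (((hasDerivAt_id (0 : ℝ)).const_mul (O⁻¹ * D).trace).const_add 1).add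
      ((p.hasDerivAt 0).mul (hasDerivAt_pow 2 (0 : ℝ)))
    refine (h1.congr_deriv (by simp)).congr_of_eventuallyEq (.of_forall fun t => ?_)
    simp
  refine IsLocalMax.hasDerivAt_eq_zero (f := fun t : ℝ => 1 + (O⁻¹ * D).trace * t +
    p.eval t * t ^ 2) ?_ hder
  filter_upwards [h] with t ht
  rw [← det_one_add_smul, mul_zero, add_zero, zero_pow two_ne_zero, mul_zero, add_zero]
  have : O + t • D = O * (1 + t • (O⁻¹ * D)) := by
    rw [Matrix.mul_add, Matrix.mul_one, Matrix.mul_smul, mul_nonsing_inv_cancel_left _ _ hO.isUnit_det]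
  rw [this, det_mul] at ht
  have hp := hO.det_pos
  nlinarith

end Matrix

/-! ### Block matrices -/

section BlockAlgebra

variable {p q r m : ℕ}

@[simp]
theorem ofBlocks_apply (F : Fin p → Fin q → Blk m) (i : Fin p) (a : Fin m) (j : Fin q)
    (b : Fin m) : ofBlocks F (i, a) (j, b) = F i j a b := rfl

@[simp]
theorem blockAt_apply (C : BlockMat p q m) (i : Fin p) (j : Fin q) (a b : Fin m) :
    blockAt C i j a b = C (i, a) (j, b) := rfl

@[simp]
theorem blockAt_ofBlocks (F : Fin p → Fin q → Blk m) (i : Fin p) (j : Fin q) :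
    blockAt (ofBlocks F) i j = F i j := rfl

theorem blockMat_ext {C D : BlockMat p q m} (h : ∀ i j, blockAt C i j = blockAt D i j) :
    C = D := by
  ext ⟨i, a⟩ ⟨j, b⟩
  exact congrFun (congrFun (h i j) a) b

@[simp]
theorem blockAt_mul (C : BlockMat p q m) (D : BlockMat q r m) (i : Fin p) (j : Fin r) :
    blockAt (C * D) i j = ∑ k, blockAt C i k * blockAt D k j := by
  ext a b
  simp [Matrix.mul_apply, Matrix.sum_apply, Fintype.sum_prod_type]

@[simp]
theorem blockAt_transpose (C : BlockMat p q m) (i : Fin q) (j : Fin p) :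
    blockAt Cᵀ i j = (blockAt C j i)ᵀ := rfl

@[simp]
theorem blockAt_add (C D : BlockMat p q m) (i : Fin p) (j : Fin q) :
    blockAt (C + D) i j = blockAt C i j + blockAt D i j := rfl

@[simp]
theorem blockAt_sub (C D : BlockMat p q m) (i : Fin p) (j : Fin q) :
    blockAt (C - D) i j = blockAt C i j - blockAt D i j := rfl

@[simp]
theorem blockAt_smul (t : ℝ) (C : BlockMat p q m) (i : Fin p) (j : Fin q) :
    blockAt (t • C) i j = t • blockAt C i j := rfl

@[simp]
theorem blockAt_one (i j : Fin p) :
    blockAt (1 : BlockMat p p m) i j = if i = j then 1 else 0 := by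
  ext a b
  by_cases h : i = j <;> simp [h, Matrix.one_apply]

theorem trace_eq_sum_blockAt (C : BlockMat p p m) : C.trace = ∑ i, (blockAt C i i).trace := by
  simp [Matrix.trace, Fintype.sum_prod_type]

theorem norm_le_sum_norm_blockAt (C : BlockMat p q m) :
    ‖C‖ ≤ m ^ 2 * ∑ i, ∑ j, ‖blockAt C i j‖ := by
  refine (Matrix.frobenius_le_sum_abs C).trans ?_
  simp only [Fintype.sum_prod_type, Finset.mul_sum]
  refine Finset.sum_le_sum fun i _ => ?_
  rw [Finset.sum_comm]
  refine Finset.sum_le_sum fun j _ => ?_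
  calc ∑ a, ∑ b, |C (i, a) (j, b)| ≤ ∑ _a : Fin m, ∑ _b : Fin m, ‖blockAt C i j‖ :=
        Finset.sum_le_sum fun a _ => Finset.sum_le_sum fun b _ =>
          Matrix.abs_entry_le_frobenius (blockAt C i j) a b
    _ = _ := by simp; ring

theorem norm_le_of_norm_blockAt_le (C : BlockMat p p m) {c : ℝ}
    (h : ∀ i j, ‖blockAt C i j‖ ≤ c) : ‖C‖ ≤ m ^ 2 * c * p ^ 2 := by
  refine (norm_le_sum_norm_blockAt C).trans ?_
  calc (m : ℝ) ^ 2 * ∑ i, ∑ j, ‖blockAt C i j‖ ≤ m ^ 2 * ∑ _i : Fin p, ∑ _j : Fin p, c := by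
        gcongr with i _ j _
        exact h i j
    _ = _ := by simp; ring

end BlockAlgebra

/-! ### The constraints in terms of blocks -/

section Constraints

variable {n m N : ℕ}

theorem blockAt_blockE_conj (hN : n + 1 ≤ N) (C : BlockMat N N m) (i j : Fin (n + 1)) :
    blockAt ((blockE N n m)ᵀ * C * blockE N n m) i j
      = blockAt C (Fin.castLE hN i) (Fin.castLE hN j) := by
  have h (k : Fin N) (i : Fin (n + 1)) : k.1 = i.1 ↔ k = Fin.castLE hN i := by
    simp [Fin.ext_iff]
  simp [blockE, h, apply_ite Matrix.transpose]

theorem blockE_conj_eq_iff (hN : n + 1 ≤ N) (C : BlockMat N N m)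
    (T : BlockMat (n + 1) (n + 1) m) :
    (blockE N n m)ᵀ * C * blockE N n m = T ↔
      ∀ i j, blockAt C (Fin.castLE hN i) (Fin.castLE hN j) = blockAt T i j := by
  simp only [← blockAt_blockE_conj]
  exact ⟨fun h => by simp [h], blockMat_ext⟩

theorem blockA_conj_eq_blockB_conj_iff (C : BlockMat N N m) :
    blockA N m * C * (blockA N m)ᵀ = blockB N m * C * (blockB N m)ᵀ ↔
      ∀ i j (hi : i + 1 < N) (hj : j + 1 < N),
        blockAt C ⟨i, by omega⟩ ⟨j, by omega⟩ = blockAt C ⟨i + 1, hi⟩ ⟨j + 1, hj⟩ := by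
  have hA (i j : Fin (N - 1)) : blockAt (blockA N m * C * (blockA N m)ᵀ) i j
      = blockAt C ⟨i, by omega⟩ ⟨j, by omega⟩ := by
    have h : blockA N m = ofBlocks fun (i : Fin (N - 1)) (k : Fin N) =>
        if k = ⟨i.1, by omega⟩ then 1 else 0 := by simp [blockA, Fin.ext_iff]
    simp [h, apply_ite Matrix.transpose]
  have hB (i j : Fin (N - 1)) : blockAt (blockB N m * C * (blockB N m)ᵀ) i j
      = blockAt C ⟨i + 1, by omega⟩ ⟨j + 1, by omega⟩ := by
    have h : blockB N m = ofBlocks fun (i : Fin (N - 1)) (k : Fin N) =>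
        if k = ⟨i.1 + 1, by omega⟩ then 1 else 0 := by simp [blockB, Fin.ext_iff]
    simp [h, apply_ite Matrix.transpose]
  constructor
  · intro h i j hi hj
    have := congrArg (fun D => blockAt D ⟨i, by omega⟩ ⟨j, by omega⟩) h
    simpa only [hA, hB] using this
  · intro h
    refine blockMat_ext fun i j => ?_
    rw [hA, hB]
    exact h i j _ _

theorem blockU_eq [NeZero N] :
    blockU N m = ofBlocks fun i j : Fin N => if j = i + 1 then 1 else 0 := by
  simp [blockU, Fin.ext_iff, Fin.val_add]

theorem isBlockCirculant_iff [NeZero N] (C : BlockMat N N m) :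
    IsBlockCirculant C ↔ ∀ i j, blockAt C (i + 1) (j + 1) = blockAt C i j := by
  have h (i j : Fin N) : blockAt ((blockU N m)ᵀ * C * blockU N m) i j
      = blockAt C (i - 1) (j - 1) := by
    have h' (i k : Fin N) : i = k + 1 ↔ k = i - 1 := by rw [eq_sub_iff_add_eq, eq_comm]
    simp [blockU_eq, h', apply_ite Matrix.transpose]
  constructor
  · intro hC i j
    conv_lhs => rw [← hC]
    simp [h]
  · intro hC
    refine blockMat_ext fun i j => ?_
    rw [h, ← hC, sub_add_cancel, sub_add_cancel]

end Constraints

/-! ### Block-Toeplitz matrices of bi-infinite sequences -/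

/-- The `N × N` block-Toeplitz matrix whose `(i, j)` block is `G (i - j)`. -/
def toeplZ {m : ℕ} (G : ℤ → Blk m) (N : ℕ) : BlockMat N N m :=
  ofBlocks fun i j => G (i.1 - j.1)

/-- The extension of a one-sided sequence to `ℤ` with `G (-k) = (G k)ᵀ`. -/
def symmExt {m : ℕ} (s : ℕ → Blk m) (z : ℤ) : Blk m :=
  if 0 ≤ z then s z.natAbs else (s z.natAbs)ᵀ

section Toeplitz

variable {n m : ℕ}

@[simp]
theorem blockAt_toeplZ (G : ℤ → Blk m) (N : ℕ) (i j : Fin N) :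
    blockAt (toeplZ G N) i j = G (i.1 - j.1) := rfl

theorem symmExt_natCast (s : ℕ → Blk m) (k : ℕ) : symmExt s k = s k := by simp [symmExt]

theorem symmExt_transpose {s : ℕ → Blk m} (h0 : (s 0)ᵀ = s 0) (z : ℤ) :
    (symmExt s z)ᵀ = symmExt s (-z) := by
  rcases lt_trichotomy z 0 with h | rfl | h
  · simp [symmExt, h.le, h.not_ge]
  · simpa [symmExt] using h0
  · simp [symmExt, h.le, h.not_ge]

theorem toepl_eq_toeplZ {s : ℕ → Blk m} (h0 : (s 0)ᵀ = s 0) (N : ℕ) :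
    (toepl fun k : Fin N => (s k.1)ᵀ) = toeplZ (symmExt s) N := by
  refine blockMat_ext fun i j => ?_
  rw [blockAt_toeplZ, toepl, blockAt_ofBlocks]
  split_ifs with h
  · have : ((i.1 : ℤ) - j.1) = -((j.1 - i.1 : ℕ) : ℤ) := by
      have : i.1 ≤ j.1 := h
      omega
    rw [this, ← symmExt_transpose h0, symmExt_natCast]
  · have : ((i.1 : ℤ) - j.1) = ((i.1 - j.1 : ℕ) : ℤ) := by
      have : ¬ i.1 ≤ j.1 := h
      omega
    rw [this, symmExt_natCast, Matrix.transpose_transpose]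

theorem isSymm_of_dataToepl_posDef {S : Fin (n + 1) → Blk m} (hT : (dataToepl S).PosDef) :
    (S 0)ᵀ = S 0 := by
  have := congrArg (fun D => blockAt D 0 0) hT.isSymm
  simpa [dataToepl, toepl] using this.symm

theorem dataToepl_eq_toeplZ {S : Fin (n + 1) → Blk m} {s : ℕ → Blk m}
    (hT : (dataToepl S).PosDef) (hs : ∀ k : Fin (n + 1), s k = S k) :
    dataToepl S = toeplZ (symmExt s) (n + 1) := by
  rw [← toepl_eq_toeplZ, dataToepl]
  · simp [hs]
  · have := hs 0
    rw [Fin.val_zero] at this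
    rw [this, isSymm_of_dataToepl_posDef hT]

/-- A block-Toeplitz matrix is determined by its first block row and column. -/
theorem blockAt_eq_of_toeplitz {N : ℕ} {C : BlockMat N N m}
    (hC : ∀ i j (hi : i + 1 < N) (hj : j + 1 < N),
      blockAt C ⟨i, by omega⟩ ⟨j, by omega⟩ = blockAt C ⟨i + 1, hi⟩ ⟨j + 1, hj⟩)
    (k i j : ℕ) (hi : i + k < N) (hj : j + k < N) :
    blockAt C ⟨i + k, hi⟩ ⟨j + k, hj⟩ = blockAt C ⟨i, by omega⟩ ⟨j, by omega⟩ := by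
  induction k with
  | zero => rfl
  | succ k ih => exact (hC (i + k) (j + k) hi hj).symm.trans (ih _ _)

end Toeplitz

/-! ### Autoregressive covariance sequences -/

/-- `G` is the covariance sequence of a stationary autoregressive process of order `n` with
coefficients `A 0 = 1, A 1, …, A n` and innovation covariance `Λ`. -/
structure IsAutoregressive {m : ℕ} (n : ℕ) (A : ℕ → Blk m) (Λ : Blk m) (G : ℤ → Blk m) :
    Prop where
  coeff_zero : A 0 = 1
  innovation_posDef : Λ.PosDef
  transpose : ∀ z, (G z)ᵀ = G (-z)
  posDef : (toeplZ G (n + 1)).PosDef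
  yule_walker : ∀ j : ℕ, ∑ k ∈ Finset.range (n + 1), A k * G (j - k) = if j = 0 then Λ else 0

section Existence

variable {n m : ℕ}

/-- The sequence that continues `S` by the recursion with coefficients `A`. -/
noncomputable def arSeq (S : Fin (n + 1) → Blk m) (A : ℕ → Blk m) : ℕ → Blk m
  | k => if h : k ≤ n then S ⟨k, by omega⟩
    else -∑ l : Fin n, A (l + 1) * arSeq S A (k - (l + 1))
  decreasing_by omega

theorem arSeq_of_lt (S : Fin (n + 1) → Blk m) (A : ℕ → Blk m) (k : Fin (n + 1)) :
    arSeq S A k = S k := by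
  rw [arSeq, dif_pos (by omega)]

theorem arSeq_of_gt (S : Fin (n + 1) → Blk m) (A : ℕ → Blk m) {k : ℕ} (hk : n < k) :
    arSeq S A k = -∑ l ∈ Finset.range n, A (l + 1) * arSeq S A (k - (l + 1)) := by
  rw [arSeq, dif_neg (by omega),
    Fin.sum_univ_eq_sum_range (fun l => A (l + 1) * arSeq S A (k - (l + 1)))]

/-- The last block row of T⁻¹ T = 1, multiplied by the inverse of the corner block X, is the
Yule-Walker system at lags 0 to n, with Λ = X⁻¹. At lags beyond n the equations hold by the
recursion defining `arSeq`. -/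
theorem exists_isAutoregressive {S : Fin (n + 1) → Blk m} (hT : (dataToepl S).PosDef) :
    ∃ (A : ℕ → Blk m) (Λ : Blk m) (s : ℕ → Blk m), (∀ k : Fin (n + 1), s k = S k) ∧
      (s 0)ᵀ = s 0 ∧ IsAutoregressive n A Λ (symmExt s) := by
  set T := dataToepl S with hTdef
  set X : Blk m := blockAt T⁻¹ (Fin.last n) (Fin.last n) with hXdef
  have hX : X.PosDef :=
    hT.inv.submatrix (e := fun a : Fin m => (Fin.last n, a)) (Prod.mk_right_injective _)
  -- The truncated subtraction gives A k = A n for k > n; these values are never used.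
  set A : ℕ → Blk m := fun k => X⁻¹ * blockAt T⁻¹ (Fin.last n) ⟨n - k, by omega⟩ with hA
  have hA0 : A 0 = 1 := by
    have : (⟨n - 0, by omega⟩ : Fin (n + 1)) = Fin.last n := rfl
    rw [hA]
    exact Matrix.nonsing_inv_mul _ hX.isUnit_det
  have hs := arSeq_of_lt S A
  have hs0 : (arSeq S A 0)ᵀ = arSeq S A 0 := by
    have := hs 0
    rw [Fin.val_zero] at this
    rw [this, isSymm_of_dataToepl_posDef hT]
  have hTZ : T = toeplZ (symmExt (arSeq S A)) (n + 1) := dataToepl_eq_toeplZ hT hs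
  refine ⟨A, X⁻¹, arSeq S A, hs, hs0, hA0, hX.inv, symmExt_transpose hs0, hTZ ▸ hT, fun j => ?_⟩
  rcases le_or_gt j n with hj | hj
  · have h1 : blockAt (T⁻¹ * T) (Fin.last n) ⟨n - j, by omega⟩ = if j = 0 then 1 else 0 := by
      rw [Matrix.nonsing_inv_mul _ hT.isUnit_det, blockAt_one]
      have : Fin.last n = ⟨n - j, by omega⟩ ↔ j = 0 := by
        rw [Fin.ext_iff]
        change n = n - j ↔ j = 0
        omega
      simp only [this]
    rw [blockAt_mul] at h1
    have h2 : ∑ k ∈ Finset.range (n + 1), A k * symmExt (arSeq S A) (j - k)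
        = X⁻¹ * ∑ k, blockAt T⁻¹ (Fin.last n) k * blockAt T k ⟨n - j, by omega⟩ := by
      rw [← Finset.sum_range_reflect, ← Fin.sum_univ_eq_sum_range
        (fun k => A (n + 1 - 1 - k) * symmExt (arSeq S A) (j - (n + 1 - 1 - k : ℕ))),
        Finset.mul_sum]
      refine Finset.sum_congr rfl fun k _ => ?_
      have e0 : blockAt T k ⟨n - j, by omega⟩ = symmExt (arSeq S A) (k - (n - j : ℕ)) := by
        rw [hTZ, blockAt_toeplZ]
      rw [e0, ← Matrix.mul_assoc]
      have e1 : (⟨n - (n + 1 - 1 - k), by omega⟩ : Fin (n + 1)) = k := by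
        ext
        simp only
        omega
      have e2 : ((j : ℤ) - (n + 1 - 1 - k : ℕ)) = k - (n - j : ℕ) := by omega
      simp only [hA, e1, e2]
    rw [h2, h1]
    split_ifs <;> simp
  · have h1 : ∀ k ≤ n, symmExt (arSeq S A) (j - k) = arSeq S A (j - k) := fun k hk => by
      rw [← symmExt_natCast (arSeq S A), Nat.cast_sub (by omega)]
    rw [Finset.sum_range_succ', hA0, Matrix.one_mul, h1 0 (Nat.zero_le _), Nat.sub_zero,
      arSeq_of_gt S A hj, if_neg (by omega), add_neg_eq_zero]
    refine Finset.sum_congr rfl fun k hk => ?_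
    rw [h1 _ (by rw [Finset.mem_range] at hk; omega)]

end Existence

/-! ### Bordered positive definite matrices -/

namespace Matrix

variable {ι κ : Type*} [Fintype ι] [Fintype κ] [DecidableEq ι] [DecidableEq κ]

/-- The matrix is V Vᵀ up to factoring T = M Mᵀ and Λ = K Kᵀ, with V block lower triangular with
rows (M, 0) and (-r M, K). -/
theorem PosDef.bordered {T : Matrix ι ι ℝ} {Λ : Matrix κ κ ℝ} (hT : T.PosDef) (hΛ : Λ.PosDef)
    (r : Matrix κ ι ℝ) :
    (fromBlocks T (-(T * rᵀ)) (-(r * T)) (Λ + r * T * rᵀ)).PosDef := by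
  obtain ⟨M, hM, hM'⟩ := hT.exists_mul_transpose
  obtain ⟨K, hK, hK'⟩ := hΛ.exists_mul_transpose
  have hV : IsUnit (fromBlocks M 0 (-(r * M)) K).det := by
    rw [det_fromBlocks_zero₁₂]
    exact hM.mul hK
  convert (posDef_mul_mul_transpose_iff hV).mpr PosDef.one using 1
  rw [Matrix.mul_one, fromBlocks_transpose, fromBlocks_multiply, hM', hK']
  simp [transpose_mul, Matrix.mul_assoc, add_comm]

/-- The Schur complement is Λ, so the inverse is T⁻¹ padded by zeros plus (r 1)ᵀ Λ⁻¹ (r 1). Only the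
support of r is affected, which is what preserves bandedness. -/
theorem inv_bordered {T : Matrix ι ι ℝ} {Λ : Matrix κ κ ℝ} (hT : IsUnit T.det)
    (hΛ : IsUnit Λ.det) (r : Matrix κ ι ℝ) :
    (fromBlocks T (-(T * rᵀ)) (-(r * T)) (Λ + r * T * rᵀ))⁻¹
      = fromBlocks (T⁻¹ + rᵀ * Λ⁻¹ * r) (rᵀ * Λ⁻¹) (Λ⁻¹ * r) Λ⁻¹ := by
  apply inv_eq_left_inv
  rw [fromBlocks_multiply, ← fromBlocks_one]
  congr 1
  · simp [Matrix.add_mul, nonsing_inv_mul _ hT, Matrix.mul_assoc]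
  · simp only [Matrix.add_mul, Matrix.mul_add, Matrix.mul_neg, Matrix.mul_assoc,
      nonsing_inv_mul _ hΛ, nonsing_inv_mul_cancel_left _ _ hT, Matrix.mul_one]
    abel
  · simp [Matrix.mul_assoc]
  · simp [Matrix.mul_add, nonsing_inv_mul _ hΛ, Matrix.mul_assoc]

end Matrix

/-! ### Positivity and banded inverses -/

/-- A single block as a block matrix. -/
def singleBlock {m : ℕ} (B : Blk m) : BlockMat 1 1 m := ofBlocks fun _ _ => B

@[simp]
theorem blockAt_singleBlock {m : ℕ} (B : Blk m) (i j : Fin 1) :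
    blockAt (singleBlock B) i j = B := rfl

/-- The splitting of the block indices `0, …, N` into `0, …, N - 1` and `N`. -/
def lastBlockEquiv (N m : ℕ) : (Fin N × Fin m) ⊕ (Fin 1 × Fin m) ≃ Fin (N + 1) × Fin m :=
  (Equiv.sumProdDistrib _ _ _).symm.trans (finSumFinEquiv.prodCongr (Equiv.refl _))

@[simp]
theorem lastBlockEquiv_inl {N m : ℕ} (i : Fin N) (a : Fin m) :
    lastBlockEquiv N m (Sum.inl (i, a)) = (i.castSucc, a) := rfl

@[simp]
theorem lastBlockEquiv_inr {N m : ℕ} (i : Fin 1) (a : Fin m) :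
    lastBlockEquiv N m (Sum.inr (i, a)) = (Fin.last N, a) := by
  rw [Subsingleton.elim i 0]
  rfl

namespace IsAutoregressive

variable {n m : ℕ} {A : ℕ → Blk m} {Λ : Blk m} {G : ℤ → Blk m}

/-- The one-step prediction row: the last block row of the whitening matrix. -/
def predictionRow (n : ℕ) (A : ℕ → Blk m) (N : ℕ) : BlockMat 1 N m :=
  ofBlocks fun _ j => if N - j.1 ≤ n then A (N - j.1) else 0

theorem sum_tail (h : IsAutoregressive n A Λ G) (j : ℕ) :
    ∑ k ∈ Finset.range n, A (k + 1) * G (j - (k + 1 : ℕ)) = (if j = 0 then Λ else 0) - G j := by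
  have := h.yule_walker j
  rw [Finset.sum_range_succ', h.coeff_zero, Matrix.one_mul, Nat.cast_zero, sub_zero] at this
  rw [← this, add_sub_cancel_right]

theorem predictionRow_mul (h : IsAutoregressive n A Λ G) {N : ℕ} (hN : n ≤ N) (j : Fin N) :
    blockAt (predictionRow n A N * toeplZ G N) 0 j = -G (N - j) := by
  rw [blockAt_mul]
  simp only [predictionRow, blockAt_ofBlocks, blockAt_toeplZ]
  rw [Fin.sum_univ_eq_sum_range (fun k => (if N - k ≤ n then A (N - k) else 0) * G (k - j)),
    ← Finset.sum_range_reflect]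
  have h1 := h.sum_tail (N - j.1)
  rw [if_neg (by omega), zero_sub, Nat.cast_sub j.2.le] at h1
  rw [← h1, ← Finset.sum_subset (Finset.range_mono hN)]
  · refine Finset.sum_congr rfl fun k hk => ?_
    rw [Finset.mem_range] at hk
    have e : N - (N - 1 - k) = k + 1 := by omega
    rw [e, if_pos (by omega)]
    congr 2
    omega
  · intro k hk hk'
    rw [Finset.mem_range] at hk hk'
    rw [if_neg (by omega), Matrix.zero_mul]

theorem mul_predictionRow_transpose (h : IsAutoregressive n A Λ G) {N : ℕ} (hN : n ≤ N) :
    blockAt (predictionRow n A N * toeplZ G N * (predictionRow n A N)ᵀ) 0 0 = G 0 - Λ := by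
  rw [blockAt_mul]
  simp only [h.predictionRow_mul hN, blockAt_transpose]
  simp only [predictionRow, blockAt_ofBlocks]
  rw [Fin.sum_univ_eq_sum_range (fun k => -G (N - k) * (if N - k ≤ n then A (N - k) else 0)ᵀ),
    ← Finset.sum_range_reflect]
  have h1 := congrArg Matrix.transpose (h.sum_tail 0)
  rw [if_pos rfl, Matrix.transpose_sub, h.innovation_posDef.isSymm, Nat.cast_zero, h.transpose,
    neg_zero, Matrix.transpose_sum] at h1
  rw [← neg_sub, ← h1, ← Finset.sum_neg_distrib, ← Finset.sum_subset (Finset.range_mono hN)]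
  · refine Finset.sum_congr rfl fun k hk => ?_
    rw [Finset.mem_range] at hk
    have e : N - (N - 1 - k) = k + 1 := by omega
    have e' : (N : ℤ) - (N - 1 - k : ℕ) = (k + 1 : ℕ) := by omega
    rw [e, e', if_pos (by omega), Matrix.transpose_mul, h.transpose, Matrix.neg_mul]
    simp
  · intro k hk hk'
    rw [Finset.mem_range] at hk hk'
    rw [if_neg (by omega), Matrix.transpose_zero, Matrix.mul_zero]

theorem toeplZ_transpose (h : IsAutoregressive n A Λ G) (N : ℕ) : (toeplZ G N)ᵀ = toeplZ G N :=
  blockMat_ext fun i j => by simp [h.transpose]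

/-- Yule-Walker at positive lags identifies the new block row, and at lag 0 the new corner. The
prediction row has only n nonzero blocks at most, whatever the size N. -/
theorem toeplZ_succ (h : IsAutoregressive n A Λ G) {N : ℕ} (hN : n ≤ N) :
    (toeplZ G (N + 1)).submatrix (lastBlockEquiv N m) (lastBlockEquiv N m) =
      Matrix.fromBlocks (toeplZ G N) (-(toeplZ G N * (predictionRow n A N)ᵀ))
        (-(predictionRow n A N * toeplZ G N))
        (singleBlock Λ +
          predictionRow n A N * toeplZ G N * (predictionRow n A N)ᵀ) := by
  have hrow := fun j => h.predictionRow_mul hN j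
  have hcol : toeplZ G N * (predictionRow n A N)ᵀ
      = (predictionRow n A N * toeplZ G N)ᵀ := by
    rw [Matrix.transpose_mul, h.toeplZ_transpose]
  have hdiag := h.mul_predictionRow_transpose hN
  rw [hcol]
  ext (⟨i, a⟩ | ⟨i, a⟩) (⟨j, b⟩ | ⟨j, b⟩)
  · simp [toeplZ]
  · have := congrFun (congrFun (hrow i) b) a
    rw [blockAt_apply] at this
    rw [Subsingleton.elim j 0, Matrix.submatrix_apply, Matrix.fromBlocks_apply₁₂,
      Matrix.neg_apply, Matrix.transpose_apply, this]
    have e := congrFun (congrFun (h.transpose (N - i)) a) b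
    rw [Matrix.transpose_apply] at e
    simp [toeplZ, e]
  · have := congrFun (congrFun (hrow j) a) b
    rw [blockAt_apply] at this
    rw [Subsingleton.elim i 0, Matrix.submatrix_apply, Matrix.fromBlocks_apply₂₁,
      Matrix.neg_apply, this]
    simp [toeplZ]
  · have := congrFun (congrFun hdiag a) b
    rw [blockAt_apply] at this
    rw [Subsingleton.elim i 0, Subsingleton.elim j 0, Matrix.submatrix_apply,
      Matrix.fromBlocks_apply₂₂, Matrix.add_apply, this]
    simp [toeplZ, singleBlock]

theorem posDef_innovation_block (h : IsAutoregressive n A Λ G) :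
    (singleBlock Λ).PosDef := by
  refine h.innovation_posDef.submatrix (e := Prod.snd) fun x y hxy => ?_
  exact Prod.ext (Subsingleton.elim _ _) hxy

theorem posDef_toeplZ_and_banded (h : IsAutoregressive n A Λ G) {N : ℕ} (hN : n + 1 ≤ N) :
    (toeplZ G N).PosDef ∧
      ∀ i j : Fin N, i.1 + n < j ∨ j.1 + n < i → blockAt (toeplZ G N)⁻¹ i j = 0 := by
  induction N, hN using Nat.le_induction with
  | base => exact ⟨h.posDef, fun i j hij => by omega⟩
  | succ N hN ih =>
    have hN' : n ≤ N := by omega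
    obtain ⟨hT, hB⟩ := ih
    have hΛ := h.posDef_innovation_block
    have hs := h.toeplZ_succ hN'
    have hpd := hT.bordered hΛ (predictionRow n A N)
    have hinv := Matrix.inv_bordered hT.isUnit_det hΛ.isUnit_det (predictionRow n A N)
    rw [← hs] at hpd hinv
    rw [Matrix.inv_submatrix_equiv] at hinv
    have hr (j : Fin N) (hj : j.1 + n < N) : blockAt (predictionRow n A N) 0 j = 0 := by
      simp only [predictionRow, blockAt_ofBlocks]
      rw [if_neg (by omega)]
    constructor
    · have := hpd.submatrix (lastBlockEquiv N m).symm.injective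
      simpa using this
    · intro i j hij
      ext a b
      induction i using Fin.lastCases with
      | last =>
        induction j using Fin.lastCases with
        | last => simp at hij
        | cast j =>
          have e := congrFun (congrFun hinv (Sum.inr (0, a))) (Sum.inl (j, b))
          rw [Matrix.submatrix_apply, lastBlockEquiv_inl, lastBlockEquiv_inr,
            Matrix.fromBlocks_apply₂₁] at e
          refine e.trans (congrFun (congrFun (?_ : blockAt ((singleBlock Λ)⁻¹ * predictionRow n A N) 0 j = 0) a) b)
          rw [blockAt_mul, Fin.sum_univ_one, hr j ?_, Matrix.mul_zero]
          simp only [Fin.val_last, Fin.val_castSucc] at hij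
          omega
      | cast i =>
        induction j using Fin.lastCases with
        | last =>
          have e := congrFun (congrFun hinv (Sum.inl (i, a))) (Sum.inr (0, b))
          rw [Matrix.submatrix_apply, lastBlockEquiv_inl, lastBlockEquiv_inr,
            Matrix.fromBlocks_apply₁₂] at e
          refine e.trans (congrFun (congrFun (?_ : blockAt ((predictionRow n A N)ᵀ * (singleBlock Λ)⁻¹) i 0 = 0) a) b)
          rw [blockAt_mul, Fin.sum_univ_one, blockAt_transpose, hr i ?_,
            Matrix.transpose_zero, Matrix.zero_mul]
          simp only [Fin.val_last, Fin.val_castSucc] at hij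
          omega
        | cast j =>
          simp only [Fin.val_castSucc] at hij
          have e := congrFun (congrFun hinv (Sum.inl (i, a))) (Sum.inl (j, b))
          rw [Matrix.submatrix_apply, lastBlockEquiv_inl, lastBlockEquiv_inl,
            Matrix.fromBlocks_apply₁₁] at e
          refine e.trans (congrFun (congrFun (?_ : blockAt ((toeplZ G N)⁻¹ +
            (predictionRow n A N)ᵀ * (singleBlock Λ)⁻¹ * predictionRow n A N) i j = 0) a) b)
          rw [blockAt_add, hB i j hij, zero_add, blockAt_mul, Fin.sum_univ_one]
          rcases hij with hij | hij
          · rw [blockAt_mul, Fin.sum_univ_one, blockAt_transpose, hr i (by omega),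
              Matrix.transpose_zero, Matrix.zero_mul, Matrix.zero_mul]
          · rw [hr j (by omega), Matrix.mul_zero]

end IsAutoregressive

/-! ### The Toeplitz maximum entropy problem -/

/-- The pairing of two block matrices with disjoint block supports vanishes. -/
theorem trace_mul_eq_zero_of_blockAt {N m : ℕ} {C D : BlockMat N N m}
    (h : ∀ i j, blockAt C i j = 0 ∨ blockAt D j i = 0) : (C * D).trace = 0 := by
  rw [trace_eq_sum_blockAt]
  refine Finset.sum_eq_zero fun i _ => ?_
  rw [blockAt_mul, Finset.sum_eq_zero, Matrix.trace_zero]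
  intro j _
  rcases h i j with h | h <;> simp [h]

section TME

variable {n m : ℕ} {S : Fin (n + 1) → Blk m}

/-- Two block-Toeplitz extensions of the same data agree in the central band. -/
theorem blockAt_eq_of_mem_toeplitzExtensions {N : ℕ} (hN : n + 1 ≤ N) {C D : BlockMat N N m}
    (hC : C ∈ toeplitzExtensions S N) (hD : D ∈ toeplitzExtensions S N) {i j : Fin N}
    (hij : ¬ (i.1 + n < j)) (hji : ¬ (j.1 + n < i)) : blockAt C i j = blockAt D i j := by
  have hCE := (blockE_conj_eq_iff hN C _).mp hC.2.1
  have hDE := (blockE_conj_eq_iff hN D _).mp hD.2.1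
  have hCT := blockAt_eq_of_toeplitz ((blockA_conj_eq_blockB_conj_iff C).mp hC.2.2)
  have hDT := blockAt_eq_of_toeplitz ((blockA_conj_eq_blockB_conj_iff D).mp hD.2.2)
  have key (k i j : ℕ) (hi : i + k < N) (hj : j + k < N) (hi' : i ≤ n) (hj' : j ≤ n) :
      blockAt C ⟨i + k, hi⟩ ⟨j + k, hj⟩ = blockAt D ⟨i + k, hi⟩ ⟨j + k, hj⟩ := by
    rw [hCT, hDT]
    exact (hCE ⟨i, by omega⟩ ⟨j, by omega⟩).trans (hDE ⟨i, by omega⟩ ⟨j, by omega⟩).symm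
  obtain ⟨i, hi⟩ := i
  obtain ⟨j, hj⟩ := j
  simp only at hij hji
  rcases le_total i j with h | h
  · have := key i 0 (j - i) (by omega) (by omega) (by omega) (by omega)
    simpa only [Nat.zero_add, Nat.sub_add_cancel h] using this
  · have := key j (i - j) 0 (by omega) (by omega) (by omega) (by omega)
    simpa only [Nat.zero_add, Nat.sub_add_cancel h] using this

/-- Differences of extensions vanish in the band and C⁻¹ vanishes outside it, so their pairing is
zero and `log_det_le` applies. Another maximizer D is stationary along the segment towards C; the
two conditions annihilate tr((D - C)(C⁻¹ - D⁻¹)), which forces D = C. -/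
theorem solvesTME_of_banded_inv {N : ℕ} (hN : n + 1 ≤ N) {C : BlockMat N N m}
    (hC : C ∈ toeplitzExtensions S N)
    (hB : ∀ i j : Fin N, i.1 + n < j ∨ j.1 + n < i → blockAt C⁻¹ i j = 0) :
    SolvesTME S N C ∧ ∀ D, SolvesTME S N D → D = C := by
  have htr (X : BlockMat N N m) (hX : X ∈ toeplitzExtensions S N) :
      (C⁻¹ * (X - C)).trace = 0 := by
    refine trace_mul_eq_zero_of_blockAt fun i j => ?_
    by_cases hij : i.1 + n < j ∨ j.1 + n < i
    · exact .inl (hB i j hij)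
    · rw [not_or] at hij
      refine .inr ?_
      rw [blockAt_sub, blockAt_eq_of_mem_toeplitzExtensions hN hX hC hij.2 hij.1, sub_self]
  refine ⟨⟨hC, fun X hX => hC.1.log_det_le hX.1 (htr X hX)⟩, fun D hD => ?_⟩
  have h1 : (D⁻¹ * (C - D)).trace = 0 := by
    refine Matrix.trace_inv_mul_eq_zero_of_forall_det_le hD.1.1 ?_
    filter_upwards [hD.1.1.eventually_add_smul (D := C - D)
      (by rw [Matrix.transpose_sub, hC.1.isSymm, hD.1.1.isSymm])] with t ht
    have hmem : D + t • (C - D) ∈ toeplitzExtensions S N := by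
      refine ⟨ht, ?_, ?_⟩
      · rw [blockE_conj_eq_iff hN]
        intro i j
        have e1 := (blockE_conj_eq_iff hN C _).mp hC.2.1 i j
        have e2 := (blockE_conj_eq_iff hN D _).mp hD.1.2.1 i j
        simp [e1, e2]
      · rw [blockA_conj_eq_blockB_conj_iff]
        intro i j hi hj
        have e1 := (blockA_conj_eq_blockB_conj_iff C).mp hC.2.2 i j hi hj
        have e2 := (blockA_conj_eq_blockB_conj_iff D).mp hD.1.2.2 i j hi hj
        simp [e1, e2]
    exact (Real.log_le_log_iff ht.det_pos hD.1.1.det_pos).mp (hD.2 hmem)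
  refine hD.1.1.eq_of_trace_sub_mul_inv_sub_eq_zero hC.1 ?_
  rw [Matrix.mul_sub, Matrix.trace_sub, Matrix.trace_mul_comm, htr D hD.1, zero_sub, neg_eq_zero,
    ← neg_sub C D, Matrix.neg_mul, Matrix.trace_neg, Matrix.trace_mul_comm, h1, neg_zero]

namespace IsAutoregressive

variable {A : ℕ → Blk m} {Λ : Blk m} {s : ℕ → Blk m}

theorem toeplZ_mem_toeplitzExtensions (h : IsAutoregressive n A Λ (symmExt s))
    (hT : (dataToepl S).PosDef) (hs : ∀ k : Fin (n + 1), s k = S k) {N : ℕ} (hN : n + 1 ≤ N) :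
    toeplZ (symmExt s) N ∈ toeplitzExtensions S N := by
  refine ⟨(h.posDef_toeplZ_and_banded hN).1, ?_, ?_⟩
  · rw [blockE_conj_eq_iff hN, dataToepl_eq_toeplZ hT hs]
    intro i j
    simp
  · rw [blockA_conj_eq_blockB_conj_iff]
    intro i j hi hj
    simp

theorem isMaxEntToeplitzExtension (h : IsAutoregressive n A Λ (symmExt s))
    (hT : (dataToepl S).PosDef) (hs0 : (s 0)ᵀ = s 0) (hs : ∀ k : Fin (n + 1), s k = S k) :
    IsMaxEntToeplitzExtension S s := fun N hN => by
  rw [toepl_eq_toeplZ hs0]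
  exact (solvesTME_of_banded_inv hN (h.toeplZ_mem_toeplitzExtensions hT hs hN)
    (h.posDef_toeplZ_and_banded hN).2).1

theorem eq_of_isMaxEntToeplitzExtension (h : IsAutoregressive n A Λ (symmExt s))
    (hT : (dataToepl S).PosDef) (hs0 : (s 0)ᵀ = s 0) (hs : ∀ k : Fin (n + 1), s k = S k)
    {s' : ℕ → Blk m} (hs' : IsMaxEntToeplitzExtension S s') : s' = s := by
  funext k
  -- This size is admissible and large enough for the first block row to contain the block of index
  -- k.
  have hN : n + 1 ≤ n + k + 1 := by omega
  have e := (solvesTME_of_banded_inv hN (h.toeplZ_mem_toeplitzExtensions hT hs hN)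
    (h.posDef_toeplZ_and_banded hN).2).2 _ (hs' (n + k + 1) hN)
  rw [← toepl_eq_toeplZ hs0] at e
  have e' := congrArg (fun D => (blockAt D ⟨0, by omega⟩ ⟨k, by omega⟩)ᵀ) e
  simpa [toepl] using e'

end IsAutoregressive

end TME

/-! ### Exponential decay of autoregressive covariances -/

theorem norm_blockAt_le {p q m : ℕ} (C : BlockMat p q m) (i : Fin p) (j : Fin q) :
    ‖blockAt C i j‖ ≤ ‖C‖ := by
  rw [← sq_le_sq₀ (norm_nonneg _) (norm_nonneg _), Matrix.frobenius_norm_sq,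
    Matrix.frobenius_norm_sq]
  simp only [Fintype.sum_prod_type, blockAt_apply]
  calc ∑ a, ∑ b, C (i, a) (j, b) ^ 2 ≤ ∑ a, ∑ j, ∑ b, C (i, a) (j, b) ^ 2 :=
        Finset.sum_le_sum fun a _ => Finset.single_le_sum
          (f := fun j => ∑ b, C (i, a) (j, b) ^ 2)
          (fun _ _ => Finset.sum_nonneg fun _ _ => sq_nonneg _) (Finset.mem_univ j)
    _ ≤ _ := Finset.single_le_sum (f := fun i => ∑ a, ∑ j, ∑ b, C (i, a) (j, b) ^ 2)
        (fun _ _ => Finset.sum_nonneg fun _ _ => Finset.sum_nonneg fun _ _ =>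
          Finset.sum_nonneg fun _ _ => sq_nonneg _) (Finset.mem_univ i)

/-- A submultiplicative sequence that tends to zero decays exponentially. -/
theorem exists_geometric_bound_of_submultiplicative {a : ℕ → ℝ} (h0 : ∀ k, 0 ≤ a k)
    (hmul : ∀ i j, a (i + j) ≤ a i * a j) (hlim : Tendsto a atTop (𝓝 0)) :
    ∃ C ρ : ℝ, 0 ≤ C ∧ 0 < ρ ∧ ρ < 1 ∧ ∀ k, a k ≤ C * ρ ^ k := by
  obtain ⟨K, hK, hK1⟩ := ((hlim.eventually_le_const (show (0 : ℝ) < 1 / 2 by norm_num)).and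
    (eventually_ge_atTop 1)).exists
  set ρ : ℝ := (1 / 2) ^ (1 / K : ℝ) with hρ
  have hK0 : (0 : ℝ) < K := by exact_mod_cast hK1
  have hρ0 : 0 < ρ := by positivity
  have hρ1 : ρ < 1 := Real.rpow_lt_one (by norm_num) (by norm_num) (by positivity)
  have hρK : ρ ^ K = 1 / 2 := by
    rw [hρ, ← Real.rpow_natCast, ← Real.rpow_mul (by norm_num), one_div_mul_cancel hK0.ne',
      Real.rpow_one]
  -- This sum is the constant C: it dominates a i / ρ^i for i < K, and every further K steps halve
  -- both sides because ρ^K = 1/2.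
  have hC : 0 ≤ ∑ i ∈ Finset.range K, a i * (ρ ^ i)⁻¹ :=
    Finset.sum_nonneg fun i _ => mul_nonneg (h0 i) (by positivity)
  refine ⟨_, ρ, hC, hρ0, hρ1, fun k => ?_⟩
  induction k using Nat.strong_induction_on with
  | _ k ih =>
    rcases lt_or_ge k K with hk | hk
    · rw [← div_le_iff₀ (by positivity), div_eq_mul_inv]
      exact Finset.single_le_sum (f := fun i => a i * (ρ ^ i)⁻¹)
        (fun i _ => mul_nonneg (h0 i) (by positivity)) (Finset.mem_range.mpr hk)
    · have h1 := hmul K (k - K)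
      have h2 := ih (k - K) (by omega)
      rw [Nat.add_sub_cancel' hk] at h1
      calc a k ≤ a K * a (k - K) := h1
        _ ≤ 1 / 2 * ((∑ i ∈ Finset.range K, a i * (ρ ^ i)⁻¹) * ρ ^ (k - K)) :=
          mul_le_mul hK h2 (h0 _) (by norm_num)
        _ = (∑ i ∈ Finset.range K, a i * (ρ ^ i)⁻¹) * (ρ ^ K * ρ ^ (k - K)) := by
          rw [hρK]; ring
        _ = _ := by rw [← pow_add, Nat.add_sub_cancel' hk]

/-- The companion matrix of the recursion `x t = -∑ A k * x (t - k)`. -/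
def companion {m : ℕ} (n : ℕ) (A : ℕ → Blk m) : BlockMat (n + 1) (n + 1) m :=
  ofBlocks fun i j =>
    if i.1 = 0 then (if j.1 < n then -A (j + 1) else 0) else if i.1 = j.1 + 1 then 1 else 0

/-- The covariance of `n + 1` consecutive values against the same values `k` steps earlier. -/
def laggedCov {m : ℕ} (n : ℕ) (G : ℤ → Blk m) (k : ℕ) : BlockMat (n + 1) (n + 1) m :=
  ofBlocks fun i j => G (j - i + k)

/-- The `j`-th block coordinate column. -/
def blockCol (n m j : ℕ) : BlockMat (n + 1) 1 m :=
  ofBlocks fun i _ => if i.1 = j then 1 else 0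

namespace IsAutoregressive

variable {n m : ℕ} {A : ℕ → Blk m} {Λ : Blk m} {G : ℤ → Blk m}

theorem blockAt_companion_mul_zero (D : BlockMat (n + 1) (n + 1) m) (j : Fin (n + 1)) :
    blockAt (companion n A * D) 0 j
      = -∑ l : Fin n, A (l + 1) * blockAt D l.castSucc j := by
  rw [blockAt_mul, Fin.sum_univ_castSucc, ← Finset.sum_neg_distrib]
  simp [companion]

theorem blockAt_companion_mul_succ {q : ℕ} (D : BlockMat (n + 1) q m) (i : Fin n) (j : Fin q) :
    blockAt (companion n A * D) i.succ j = blockAt D i.castSucc j := by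
  rw [blockAt_mul, Finset.sum_eq_single i.castSucc]
  · simp [companion]
  · intro b _ hb
    have : ¬ i.1 = b.1 := fun h => hb (Fin.ext h.symm)
    simp [companion, this]
  · simp

theorem companion_mul_laggedCov (h : IsAutoregressive n A Λ G) (k : ℕ) :
    companion n A * laggedCov n G k = laggedCov n G (k + 1) := by
  refine blockMat_ext fun i j => ?_
  induction i using Fin.cases with
  | zero =>
    rw [blockAt_companion_mul_zero]
    have h1 := h.sum_tail (j + k + 1)
    rw [if_neg (by omega), zero_sub] at h1
    simp only [laggedCov, blockAt_ofBlocks, Fin.val_castSucc]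
    rw [← neg_eq_iff_eq_neg] at h1
    rw [Fin.sum_univ_eq_sum_range (fun l => A (l + 1) * G (j - l + k))]
    have e : ((j : ℤ) - (0 : Fin (n + 1)).1 + (k + 1 : ℕ)) = (j + k + 1 : ℕ) := by simp; ring
    rw [e, ← h1]
    congr 1
    refine Finset.sum_congr rfl fun l _ => ?_
    congr 2
    push_cast
    ring
  | succ i =>
    rw [blockAt_companion_mul_succ]
    simp only [laggedCov, blockAt_ofBlocks, Fin.val_succ, Fin.val_castSucc]
    congr 1
    push_cast
    ring

theorem companion_pow_mul (h : IsAutoregressive n A Λ G) (k : ℕ) :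
    companion n A ^ k * laggedCov n G 0 = laggedCov n G k := by
  induction k with
  | zero => simp
  | succ k ih => rw [pow_succ', Matrix.mul_assoc, ih, h.companion_mul_laggedCov]

theorem laggedCov_posDef (h : IsAutoregressive n A Λ G) : (laggedCov n G 0).PosDef := by
  have := h.posDef.submatrix (e := fun x : Fin (n + 1) × Fin m => (Fin.rev x.1, x.2))
    (fun x y hxy => by simpa [Prod.ext_iff] using hxy)
  convert this using 1
  ext ⟨i, a⟩ ⟨j, b⟩
  have e : ((j : ℤ) - i + (0 : ℕ)) = (Fin.rev i).1 - (Fin.rev j).1 := by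
    rw [Fin.val_rev, Fin.val_rev]
    omega
  simp only [laggedCov, toeplZ, ofBlocks_apply, Matrix.submatrix_apply, e]

/-- The Stein equation of the state recursion: the covariance of the state is that of its prediction
plus the innovation covariance, which enters through the first block only. -/
theorem laggedCov_eq (h : IsAutoregressive n A Λ G) :
    laggedCov n G 0 = companion n A * laggedCov n G 0 * (companion n A)ᵀ +
      blockCol n m 0 * singleBlock Λ * (blockCol n m 0)ᵀ := by
  rw [h.companion_mul_laggedCov]
  apply Matrix.transpose_injective
  rw [Matrix.transpose_add, Matrix.transpose_mul, Matrix.transpose_transpose, Matrix.transpose_mul,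
    Matrix.transpose_mul, Matrix.transpose_transpose]
  refine blockMat_ext fun i j => ?_
  have hcol (i : Fin (n + 1)) : blockAt (blockCol n m 0) i 0 = if i.1 = 0 then 1 else 0 := rfl
  rw [blockAt_add, blockAt_mul (blockCol n m 0), Fin.sum_univ_one, hcol,
    blockAt_mul (singleBlock Λ)ᵀ, Fin.sum_univ_one, blockAt_transpose, blockAt_transpose, blockAt_transpose, hcol,
    blockAt_singleBlock, h.innovation_posDef.isSymm]
  induction i using Fin.cases with
  | zero =>
    rw [blockAt_companion_mul_zero]
    have h1 := h.sum_tail j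
    rw [← neg_sub, ← neg_eq_iff_eq_neg, eq_sub_iff_add_eq] at h1
    have e : (blockAt (laggedCov n G 0) j 0)ᵀ = G j := by simp [laggedCov, h.transpose]
    rw [e, ← h1]
    congr 1
    · rw [← Fin.sum_univ_eq_sum_range (fun l => A (l + 1) * G (j - (l + 1 : ℕ)))]
      congr 1
      refine Finset.sum_congr rfl fun l _ => ?_
      rw [blockAt_transpose, laggedCov, blockAt_ofBlocks, h.transpose]
      congr 2
      simp only [Fin.val_castSucc]
      push_cast
      ring
    · by_cases hj : j.1 = 0 <;> simp [hj]
  | succ i =>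
    rw [blockAt_companion_mul_succ]
    simp only [laggedCov, blockAt_ofBlocks, blockAt_transpose, h.transpose, Fin.val_succ,
      Fin.val_castSucc, Nat.add_eq_zero_iff, one_ne_zero, and_false, if_false, Matrix.zero_mul,
      add_zero]
    congr 1
    push_cast
    ring

/-- With Λ factored as K Kᵀ, the Stein equation makes tr(F^k P (F^k)ᵀ) drop at step k by exactly
‖F^k e₀ K‖². A nonnegative decreasing sequence converges, so the drops tend to 0, and K is
invertible. -/
theorem tendsto_companion_pow_mul_blockCol_zero (h : IsAutoregressive n A Λ G) :
    Tendsto (fun k => ‖companion n A ^ k * blockCol n m 0‖) atTop (𝓝 0) := by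
  set F := companion n A
  set P := laggedCov n G 0
  obtain ⟨K, hK, hK'⟩ := h.posDef_innovation_block.exists_mul_transpose
  set a : ℕ → ℝ := fun k => (F ^ k * P * (F ^ k)ᵀ).trace with ha
  have hstep (k : ℕ) : a k = a (k + 1) + ‖F ^ k * blockCol n m 0 * K‖ ^ 2 := by
    have e := congrArg (fun D => (F ^ k * D * (F ^ k)ᵀ).trace) h.laggedCov_eq
    simp only [Matrix.mul_add, Matrix.add_mul, Matrix.trace_add, hK'] at e
    rw [Matrix.frobenius_norm_sq_eq_trace]
    refine e.trans ?_
    simp only [ha, pow_succ, Matrix.transpose_mul, Matrix.mul_assoc]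
    rfl
  have hnonneg (k : ℕ) : 0 ≤ a k := by
    have := (h.laggedCov_posDef.posSemidef.mul_mul_conjTranspose_same (F ^ k)).trace_nonneg
    rwa [Matrix.conjTranspose_eq_transpose_of_trivial] at this
  have hanti : Antitone a := antitone_nat_of_succ_le fun k => by
    rw [hstep k]
    exact le_add_of_nonneg_right (sq_nonneg _)
  have hlim := tendsto_atTop_ciInf hanti ⟨0, by rintro _ ⟨k, rfl⟩; exact hnonneg k⟩
  have hdiff := hlim.sub (hlim.comp (tendsto_add_atTop_nat 1))
  rw [sub_self] at hdiff
  have hsq : Tendsto (fun k => ‖F ^ k * blockCol n m 0 * K‖ ^ 2) atTop (𝓝 0) :=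
    hdiff.congr fun k => by simp [hstep k]
  have hn : Tendsto (fun k => ‖F ^ k * blockCol n m 0 * K‖) atTop (𝓝 0) := by
    simpa using hsq.sqrt
  refine squeeze_zero (fun _ => norm_nonneg _) (fun k => ?_)
    (by simpa using hn.mul_const ‖K⁻¹‖)
  conv_lhs => rw [← Matrix.mul_nonsing_inv_cancel_right K (F ^ k * blockCol n m 0) hK]
  exact Matrix.frobenius_norm_mul _ _

/-- Controllability: every coordinate column is reached from the first by the companion matrix, so
decay of its powers on e₀ spreads to all columns. -/
theorem blockCol_succ {j : ℕ} (hj : j < n) :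
    blockCol n m (j + 1)
      = companion n A * blockCol n m j + blockCol n m 0 * singleBlock (A (j + 1)) := by
  refine blockMat_ext fun i k => ?_
  rw [blockAt_add, blockAt_mul, blockAt_mul, Fin.sum_univ_one,
    Finset.sum_eq_single ⟨j, by omega⟩]
  · by_cases hi : i = 0 <;> simp [blockCol, companion, hi, hj]
  · intro b _ hb
    have : ¬ b.1 = j := fun h => hb (Fin.ext h)
    simp [blockCol, this]
  · simp

theorem tendsto_companion_pow_mul_blockCol (h : IsAutoregressive n A Λ G) {j : ℕ} (hj : j ≤ n) :
    Tendsto (fun k => ‖companion n A ^ k * blockCol n m j‖) atTop (𝓝 0) := by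
  induction j with
  | zero => exact h.tendsto_companion_pow_mul_blockCol_zero
  | succ j ih =>
    have h1 := (ih (by omega)).comp (tendsto_add_atTop_nat 1)
    have h2 := h.tendsto_companion_pow_mul_blockCol_zero.mul_const
      ‖singleBlock (A (j + 1))‖
    refine squeeze_zero (fun _ => norm_nonneg _) (fun k => ?_) (by simpa using h1.add h2)
    rw [blockCol_succ (A := A) hj, Matrix.mul_add, ← Matrix.mul_assoc, ← Matrix.mul_assoc,
      ← pow_succ]
    refine (norm_add_le _ _).trans ?_
    gcongr
    exact Matrix.frobenius_norm_mul _ _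

theorem tendsto_companion_pow (h : IsAutoregressive n A Λ G) :
    Tendsto (fun k => ‖companion n A ^ k‖) atTop (𝓝 0) := by
  have hlim : Tendsto (fun k => (m : ℝ) ^ 2 * ∑ _i : Fin (n + 1), ∑ j : Fin (n + 1),
      ‖companion n A ^ k * blockCol n m j‖) atTop (𝓝 0) := by
    have := (tendsto_finsetSum (Finset.univ : Finset (Fin (n + 1))) fun _ _ =>
      tendsto_finsetSum (Finset.univ : Finset (Fin (n + 1))) fun j _ =>
        h.tendsto_companion_pow_mul_blockCol (Nat.lt_succ_iff.mp j.2)).const_mul ((m : ℝ) ^ 2)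
    simpa using this
  refine squeeze_zero (fun _ => norm_nonneg _) (fun k => ?_) hlim
  refine (norm_le_sum_norm_blockAt _).trans ?_
  gcongr with i _ j _
  have e : blockAt (companion n A ^ k) i j = blockAt (companion n A ^ k * blockCol n m j) i 0 := by
    rw [blockAt_mul, Finset.sum_eq_single j]
    · simp [blockCol]
    · intro b _ hb
      have : ¬ b.1 = j.1 := fun h => hb (Fin.ext h)
      simp [blockCol, this]
    · simp
  rw [e]
  exact norm_blockAt_le _ _ _

theorem exists_geometric_bound (h : IsAutoregressive n A Λ G) :
    ∃ C ρ : ℝ, 0 ≤ C ∧ 0 < ρ ∧ ρ < 1 ∧ ∀ z : ℤ, ‖G z‖ ≤ C * ρ ^ z.natAbs := by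
  obtain ⟨C, ρ, hC, hρ, hρ1, hb⟩ := exists_geometric_bound_of_submultiplicative
    (fun k => norm_nonneg (companion n A ^ k))
    (fun i j => by rw [pow_add]; exact Matrix.frobenius_norm_mul _ _) h.tendsto_companion_pow
  have hnat (k : ℕ) : ‖G k‖ ≤ C * ‖laggedCov n G 0‖ * ρ ^ k := by
    have e : G k = blockAt (companion n A ^ k * laggedCov n G 0) 0 0 := by
      rw [h.companion_pow_mul]
      simp [laggedCov]
    rw [e]
    calc _ ≤ ‖companion n A ^ k * laggedCov n G 0‖ := norm_blockAt_le _ _ _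
      _ ≤ ‖companion n A ^ k‖ * ‖laggedCov n G 0‖ := Matrix.frobenius_norm_mul _ _
      _ ≤ C * ρ ^ k * ‖laggedCov n G 0‖ := by gcongr; exact hb k
      _ = _ := by ring
  refine ⟨C * ‖laggedCov n G 0‖, ρ, by positivity, hρ, hρ1, fun z => ?_⟩
  rcases Int.natAbs_eq z with hz | hz
  · conv_lhs => rw [hz]
    exact hnat _
  · conv_lhs => rw [hz, ← h.transpose, Matrix.frobenius_norm_transpose]
    exact hnat _

end IsAutoregressive

/-! ### Block-circulant matrices of periodic sequences -/

section Circulant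

variable {m N : ℕ}

theorem val_add_one_modEq [NeZero N] (i : Fin N) : ((i + 1 : Fin N).1 : ℤ) ≡ i.1 + 1 [ZMOD N] := by
  rw [Fin.val_add, Fin.val_one']
  simp [Int.ModEq]

theorem val_sub_modEq (i j : Fin N) : ((i - j : Fin N).1 : ℤ) ≡ i.1 - j.1 [ZMOD N] := by
  rw [Fin.coe_int_sub_eq_mod]
  simp [Int.ModEq]

theorem isBlockCirculant_toeplZ [NeZero N] {c : ℤ → Blk m}
    (hc : ∀ x y : ℤ, x ≡ y [ZMOD N] → c x = c y) : IsBlockCirculant (toeplZ c N) := by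
  rw [isBlockCirculant_iff]
  intro i j
  rw [blockAt_toeplZ, blockAt_toeplZ]
  refine hc _ _ ?_
  simpa using (val_add_one_modEq i).sub (val_add_one_modEq j)

theorem sum_sub_eq_sum_range [NeZero N] {M : Type*} [AddCommMonoid M] {f : ℤ → M}
    (hf : ∀ x y : ℤ, x ≡ y [ZMOD N] → f x = f y) (i : Fin N) :
    ∑ k : Fin N, f (i.1 - k.1) = ∑ k ∈ Finset.range N, f k := by
  rw [← Fin.sum_univ_eq_sum_range (fun k => f k),
    ← (Equiv.subLeft i).sum_comp fun k : Fin N => f k.1]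
  exact Finset.sum_congr rfl fun k _ => hf _ _ (val_sub_modEq i k).symm

/-- The `N`-periodic sequence with values `A 0, …, A n, 0, …, 0` at `0, …, N - 1`. -/
def coeffSeq (A : ℕ → Blk m) (n N : ℕ) (z : ℤ) : Blk m :=
  if (z % N).toNat ≤ n then A (z % N).toNat else 0

/-- The `N`-periodic sequence that wraps `G` around the circle of length `N`. -/
def wrapSeq (G : ℤ → Blk m) (N : ℕ) (z : ℤ) : Blk m :=
  if 2 * (z % N) < N then G (z % N)
  else if 2 * (z % N) = N then G (z % N) + G (z % N - N) else G (z % N - N)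

theorem coeffSeq_congr (A : ℕ → Blk m) (n : ℕ) (x y : ℤ) (h : x ≡ y [ZMOD N]) :
    coeffSeq A n N x = coeffSeq A n N y := by
  rw [coeffSeq, coeffSeq, h]

theorem wrapSeq_congr (G : ℤ → Blk m) (x y : ℤ) (h : x ≡ y [ZMOD N]) :
    wrapSeq G N x = wrapSeq G N y := by
  rw [wrapSeq, wrapSeq, h]

theorem coeffSeq_natCast (A : ℕ → Blk m) (n : ℕ) {k : ℕ} (hk : k < N) :
    coeffSeq A n N k = if k ≤ n then A k else 0 := by
  have : ((k : ℤ) % N).toNat = k := by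
    rw [Int.emod_eq_of_lt (by omega) (by omega), Int.toNat_natCast]
  rw [coeffSeq, this]

theorem norm_coeffSeq_le (A : ℕ → Blk m) (n : ℕ) (z : ℤ) :
    ‖coeffSeq A n N z‖ ≤ ∑ k ∈ Finset.range (n + 1), ‖A k‖ := by
  rw [coeffSeq]
  split_ifs with h
  · exact Finset.single_le_sum (f := fun k => ‖A k‖) (fun _ _ => norm_nonneg _)
      (Finset.mem_range.mpr (by omega))
  · rw [norm_zero]
    positivity

theorem wrapSeq_of_nonneg (G : ℤ → Blk m) {z : ℤ} (h0 : 0 ≤ z) (h1 : z < N) :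
    wrapSeq G N z = if 2 * z < N then G z else if 2 * z = N then G z + G (z - N)
      else G (z - N) := by
  rw [wrapSeq, Int.emod_eq_of_lt h0 h1]

theorem wrapSeq_of_neg (G : ℤ → Blk m) {z : ℤ} (h0 : z < 0) (h1 : -N ≤ z) :
    wrapSeq G N z = if 2 * (z + N) < N then G (z + N)
      else if 2 * (z + N) = N then G (z + N) + G z else G z := by
  have : z ≡ z + N [ZMOD N] := by simp [Int.ModEq]
  rw [wrapSeq_congr G _ _ this, wrapSeq_of_nonneg G (by omega) (by omega), add_sub_cancel_right]

theorem wrapSeq_of_small (G : ℤ → Blk m) {z : ℤ} (h0 : -N < 2 * z) (h1 : 2 * z < N) :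
    wrapSeq G N z = G z := by
  rcases le_or_gt 0 z with h | h
  · rw [wrapSeq_of_nonneg G h (by omega), if_pos h1]
  · rw [wrapSeq_of_neg G h (by omega), if_neg (by omega), if_neg (by omega)]

theorem wrapSeq_transpose {G : ℤ → Blk m} (hG : ∀ z, (G z)ᵀ = G (-z)) {z : ℤ}
    (h0 : -N < z) (h1 : z < N) : (wrapSeq G N z)ᵀ = wrapSeq G N (-z) := by
  have key (z : ℤ) (h0 : 0 < z) (h1 : z < N) : (wrapSeq G N z)ᵀ = wrapSeq G N (-z) := by
    rw [wrapSeq_of_nonneg G h0.le h1, wrapSeq_of_neg G (by omega) (by omega)]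
    have e : -(z - (N : ℤ)) = -z + N := by ring
    rcases lt_trichotomy (2 * z) N with h | h | h
    · rw [if_pos h, if_neg (by omega), if_neg (by omega), hG]
    · rw [if_neg (by omega), if_pos h, if_neg (by omega), if_pos (by omega),
        Matrix.transpose_add, hG, hG, e, add_comm]
    · rw [if_neg (by omega), if_neg (by omega), if_pos (by omega), hG, e]
  rcases lt_trichotomy z 0 with h | rfl | h
  · rw [← Matrix.transpose_transpose (wrapSeq G N (-z)), key (-z) (by omega) (by omega), neg_neg]
  · rw [neg_zero, wrapSeq_of_small G (by omega) (by omega), hG, neg_zero]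
  · exact key z h h1

theorem wrapped_eq_toeplZ {s : ℕ → Blk m} (h0 : (s 0)ᵀ = s 0) (N : ℕ) :
    wrapped s N = toeplZ (wrapSeq (symmExt s) N) N := by
  have hG := symmExt_transpose h0
  have key (i j : Fin N) (hij : i ≤ j) : blockAt (wrapped s N) i j
      = wrapSeq (symmExt s) N (i.1 - j.1) := by
    have hij' : i.1 ≤ j.1 := hij
    obtain ⟨d, hd⟩ : ∃ d : ℕ, j.1 = i.1 + d := ⟨j.1 - i.1, by omega⟩
    have hdN : d < N := by omega
    have e1 : ((i.1 : ℤ) - j.1) = -(d : ℤ) := by omega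
    have e2 : j.1 - i.1 = d := by omega
    rw [e1, ← wrapSeq_transpose hG (by omega) (by omega), wrapSeq_of_nonneg _ (by omega) (by omega)]
    rw [wrapped, toepl, blockAt_ofBlocks, if_pos hij]
    simp only [e2]
    have e3 : ((d : ℤ) - N) = -((N - d : ℕ) : ℤ) := by omega
    rcases lt_trichotomy (2 * d) N with h | h | h
    · rw [if_pos h, if_pos (by omega), symmExt_natCast]
    · have e4 : N - d = d := by omega
      rw [if_neg (by omega), if_pos h, if_neg (by omega), if_pos (by omega), Matrix.transpose_add,
        e3, ← hG, symmExt_natCast, symmExt_natCast, Matrix.transpose_transpose, e4]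
    · rw [if_neg (by omega), if_neg (by omega), if_neg (by omega), if_neg (by omega),
        e3, hG, neg_neg, symmExt_natCast]
  refine blockMat_ext fun i j => ?_
  rcases le_or_gt i j with h | h
  · rw [key i j h, blockAt_toeplZ]
  · have h' : blockAt (wrapped s N) i j = (blockAt (wrapped s N) j i)ᵀ := by
      rw [wrapped, toepl, blockAt_ofBlocks, blockAt_ofBlocks, if_neg (not_le.mpr h), if_pos h.le]
    rw [h', key j i h.le, blockAt_toeplZ, wrapSeq_transpose hG (by omega) (by omega), neg_sub]

/-- The block-diagonal matrix with all diagonal blocks equal to `B`. -/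
def blockScalar (N : ℕ) (B : Blk m) : BlockMat N N m := ofBlocks fun i j => if i = j then B else 0

@[simp]
theorem blockAt_blockScalar (B : Blk m) (i j : Fin N) :
    blockAt (blockScalar N B) i j = if i = j then B else 0 := rfl

theorem blockScalar_mul (B D : Blk m) :
    blockScalar N B * blockScalar N D = blockScalar N (B * D) :=
  blockMat_ext fun i j => by
    by_cases h : i = j <;> simp [h]

theorem blockScalar_transpose (B : Blk m) : (blockScalar N B)ᵀ = blockScalar N Bᵀ :=
  blockMat_ext fun i j => by
    by_cases h : i = j <;> simp [h, eq_comm]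

theorem blockScalar_one : blockScalar N (1 : Blk m) = 1 :=
  blockMat_ext fun i j => by simp

theorem blockScalar_inv {B : Blk m} (hB : IsUnit B.det) :
    (blockScalar N B)⁻¹ = blockScalar N B⁻¹ := by
  apply Matrix.inv_eq_right_inv
  rw [blockScalar_mul, Matrix.mul_nonsing_inv _ hB, blockScalar_one]

theorem posDef_blockScalar {B : Blk m} (hB : B.PosDef) : (blockScalar N B).PosDef := by
  obtain ⟨K, hK, rfl⟩ := hB.exists_mul_transpose
  have hu : IsUnit (blockScalar N K).det :=
    Matrix.isUnit_det_of_right_inverse (B := blockScalar N K⁻¹)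
      (by rw [blockScalar_mul, Matrix.mul_nonsing_inv _ hK, blockScalar_one])
  have := (Matrix.posDef_mul_mul_transpose_iff hu).mpr Matrix.PosDef.one
  rwa [Matrix.mul_one, blockScalar_transpose, blockScalar_mul] at this

theorem trace_blockScalar (B : Blk m) : (blockScalar N B).trace = N * B.trace := by
  simp [trace_eq_sum_blockAt]

/-- The inverse-covariance matrix built from a banded whitening filter is banded. -/
theorem blockAt_whitening_eq_zero {n : ℕ} (A : ℕ → Blk m) (B : Blk m) {i j : Fin N}
    (hij : n < (i - j).1) (hji : n < (j - i).1) :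
    blockAt ((toeplZ (coeffSeq A n N) N)ᵀ * blockScalar N B * toeplZ (coeffSeq A n N) N) i j
      = 0 := by
  rw [blockAt_mul]
  refine Finset.sum_eq_zero fun k _ => ?_
  rw [blockAt_mul, Finset.sum_eq_single k (by intro b _ hb; simp [hb]) (by simp)]
  simp only [blockAt_transpose, blockAt_toeplZ, blockAt_blockScalar, if_true]
  by_contra h
  -- A nonzero term needs k to be at most n steps ahead of both i and j on the circle, and then one
  -- of i, j is at most n steps ahead of the other.
  have h1 : (((k.1 : ℤ) - i.1) % N).toNat ≤ n := by
    by_contra h'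
    rw [coeffSeq, if_neg h'] at h
    simp at h
  have h2 : (((k.1 : ℤ) - j.1) % N).toNat ≤ n := by
    by_contra h'
    rw [coeffSeq, coeffSeq, if_neg h'] at h
    simp at h
  have e1 := Fin.coe_int_sub_eq_ite i j
  have e2 := Fin.coe_int_sub_eq_ite j i
  have e3 := Fin.coe_int_sub_eq_ite k i
  have e4 := Fin.coe_int_sub_eq_ite k j
  rw [← Fin.coe_int_sub_eq_mod, Int.toNat_natCast] at h1 h2
  have := i.2
  have := j.2
  have := k.2
  simp only [Fin.le_def] at e1 e2 e3 e4
  split_ifs at e1 e2 e3 e4 <;> omega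

end Circulant

/-! ### Whitening the wrapped matrix -/

section Whitening

variable {n m N : ℕ} {A : ℕ → Blk m} {Λ : Blk m} {G : ℤ → Blk m}

/-- For r ≥ 0 the inner sum is the Yule-Walker equation at lag r + l, which is nonzero only for r =
l = 0. Negative r follows by transposition. -/
theorem IsAutoregressive.sum_whitened (h : IsAutoregressive n A Λ G) (r : ℤ) :
    ∑ l ∈ Finset.range (n + 1), (∑ k ∈ Finset.range (n + 1), A k * G (r + l - k)) * (A l)ᵀ
      = if r = 0 then Λ else 0 := by
  have key (r : ℕ) :
      ∑ l ∈ Finset.range (n + 1), (∑ k ∈ Finset.range (n + 1), A k * G (r + l - k)) * (A l)ᵀ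
      = if r = 0 then Λ else 0 := by
    have hyw (l : ℕ) := h.yule_walker (r + l)
    simp only [Nat.cast_add] at hyw
    simp only [hyw]
    rw [Finset.sum_eq_single 0]
    · simp [h.coeff_zero]
    · intro l _ hl
      simp [hl]
    · simp
  rcases le_or_gt 0 r with hr | hr
  · lift r to ℕ using hr
    simpa using key r
  · have h1 := congrArg Matrix.transpose (key (-r).toNat)
    rw [if_neg (by omega), Matrix.transpose_zero] at h1
    rw [if_neg hr.ne, ← h1, Matrix.transpose_sum]
    simp only [Finset.sum_mul, Matrix.transpose_mul, Matrix.transpose_sum,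
      Matrix.transpose_transpose, h.transpose]
    rw [Finset.sum_comm]
    refine Finset.sum_congr rfl fun k _ => Finset.sum_congr rfl fun l _ => ?_
    have e : ((-r).toNat : ℤ) = -r := by omega
    rw [e, Matrix.mul_assoc]
    congr 3
    ring

/-- Filtering shifts lags by at most n, so lags up to N/2 + n occur. There the two sequences differ
by at most two values of G, each at distance at least N/2 - n from the origin. -/
theorem norm_wrapSeq_sub_le {η : ℝ} (hη0 : 0 ≤ η)
    (hη : ∀ z : ℤ, N / 2 - n ≤ z.natAbs → ‖G z‖ ≤ η) {z : ℤ} (h0 : -(N + 2 * n) ≤ 2 * z)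
    (h1 : 2 * z ≤ N + 2 * n) (hN : 2 * n < N) : ‖wrapSeq G N z - G z‖ ≤ 2 * η := by
  have hb (z : ℤ) (hz : N / 2 - n ≤ z.natAbs) : ‖G z‖ ≤ 2 * η := (hη z hz).trans (by linarith)
  have hs (x y : ℤ) (hx : N / 2 - n ≤ x.natAbs) (hy : N / 2 - n ≤ y.natAbs) :
      ‖G x - G y‖ ≤ 2 * η := by
    refine (norm_sub_le _ _).trans ?_
    linarith [hη x hx, hη y hy]
  have h2 : 0 ≤ 2 * η := by positivity
  rcases le_or_gt 0 z with h | h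
  · rw [wrapSeq_of_nonneg G h (by omega)]
    split_ifs
    · rwa [sub_self, norm_zero]
    · rw [add_sub_cancel_left]
      exact hb _ (by omega)
    · exact hs _ _ (by omega) (by omega)
  · rw [wrapSeq_of_neg G h (by omega)]
    split_ifs
    · exact hs _ _ (by omega) (by omega)
    · rw [add_sub_cancel_right]
      exact hb _ (by omega)
    · rwa [sub_self, norm_zero]

theorem blockAt_filter_mul_wrapSeq [NeZero N] (hN : n < N) (i j : Fin N) :
    blockAt (toeplZ (coeffSeq A n N) N * toeplZ (wrapSeq G N) N *
      (toeplZ (coeffSeq A n N) N)ᵀ) i j =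
    ∑ l ∈ Finset.range (n + 1),
      (∑ k ∈ Finset.range (n + 1), A k * wrapSeq G N (i.1 - j.1 + l - k)) * (A l)ᵀ := by
  have hrange (f : ℕ → Blk m → Blk m) (hf : ∀ k, f k 0 = 0) :
      ∑ k ∈ Finset.range N, f k (coeffSeq A n N k) = ∑ k ∈ Finset.range (n + 1), f k (A k) := by
    rw [← Finset.sum_subset (Finset.range_mono (show n + 1 ≤ N from hN))]
    · refine Finset.sum_congr rfl fun k hk => ?_
      rw [Finset.mem_range] at hk
      rw [coeffSeq_natCast A n (by omega), if_pos (by omega)]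
    · intro k hk hk'
      rw [Finset.mem_range] at hk hk'
      rw [coeffSeq_natCast A n hk, if_neg (by omega), hf]
  have h1 (l : Fin N) : blockAt (toeplZ (coeffSeq A n N) N * toeplZ (wrapSeq G N) N) i l
      = ∑ k ∈ Finset.range (n + 1), A k * wrapSeq G N (i.1 - l.1 - k) := by
    rw [← hrange (fun k B => B * wrapSeq G N (i.1 - l.1 - k)) (fun _ => Matrix.zero_mul _),
      ← sum_sub_eq_sum_range (f := fun z => coeffSeq A n N z * wrapSeq G N (i.1 - l.1 - z)) _ i,
      blockAt_mul]
    · refine Finset.sum_congr rfl fun k _ => ?_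
      rw [blockAt_toeplZ, blockAt_toeplZ]
      congr 2
      ring
    · intro x y hxy
      rw [coeffSeq_congr A n x y hxy, wrapSeq_congr G _ _ (hxy.sub_left (i.1 - l.1))]
  rw [← hrange (fun l B => (∑ k ∈ Finset.range (n + 1),
      A k * wrapSeq G N (i.1 - j.1 + l - k)) * Bᵀ) (fun _ => by simp),
    ← sum_sub_eq_sum_range (f := fun z => (∑ k ∈ Finset.range (n + 1),
      A k * wrapSeq G N (i.1 - j.1 + z - k)) * (coeffSeq A n N z)ᵀ) _ j, blockAt_mul]
  · refine Finset.sum_congr rfl fun l _ => ?_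
    rw [h1, blockAt_transpose, blockAt_toeplZ]
    congr 1
    refine Finset.sum_congr rfl fun k _ => ?_
    congr 2
    ring
  · intro x y hxy
    rw [coeffSeq_congr A n x y hxy]
    congr 1
    refine Finset.sum_congr rfl fun k _ => ?_
    rw [wrapSeq_congr G _ _ ((hxy.add_left (i.1 - j.1)).sub_right k)]

theorem IsAutoregressive.norm_whitened_sub_le (h : IsAutoregressive n A Λ G) {η : ℝ} (hη0 : 0 ≤ η)
    (hη : ∀ z : ℤ, N / 2 - n ≤ z.natAbs → ‖G z‖ ≤ η) (hN : 2 * n < N) :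
    ‖toeplZ (coeffSeq A n N) N * toeplZ (wrapSeq G N) N * (toeplZ (coeffSeq A n N) N)ᵀ
        - blockScalar N Λ‖
      ≤ m ^ 2 * ((∑ k ∈ Finset.range (n + 1), ‖A k‖) ^ 2 * (2 * η)) * N ^ 2 := by
  have : NeZero N := ⟨by omega⟩
  refine norm_le_of_norm_blockAt_le _ fun i j => ?_
  -- The representative of i - j modulo N nearest to 0 keeps r + l - k within N/2 + n, where
  -- wrapping is harmless.
  obtain ⟨r, hr, hr0, hr1, hr2⟩ : ∃ r : ℤ, r ≡ i.1 - j.1 [ZMOD N] ∧ (r = 0 ↔ i = j) ∧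
      -N ≤ 2 * r ∧ 2 * r ≤ N := by
    have hi := i.2
    have hj := j.2
    simp only [Fin.ext_iff]
    rcases lt_or_ge (N : ℤ) (2 * (i.1 - j.1)) with h | h
    · exact ⟨i.1 - j.1 - N, by simp [Int.ModEq], by omega, by omega, by omega⟩
    rcases lt_or_ge (2 * ((i.1 : ℤ) - j.1)) (-N) with h' | h'
    · exact ⟨i.1 - j.1 + N, by simp [Int.ModEq], by omega, by omega, by omega⟩
    · exact ⟨i.1 - j.1, rfl, by omega, by omega, by omega⟩
  have e : blockAt (blockScalar N Λ) i j = ∑ l ∈ Finset.range (n + 1),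
      (∑ k ∈ Finset.range (n + 1), A k * G (r + l - k)) * (A l)ᵀ := by
    rw [h.sum_whitened, blockAt_blockScalar]
    simp only [hr0]
  have hw (l k : ℕ) : wrapSeq G N (i.1 - j.1 + l - k) = wrapSeq G N (r + l - k) :=
    wrapSeq_congr G _ _ ((hr.symm.add_right _).sub_right _)
  rw [blockAt_sub, blockAt_filter_mul_wrapSeq (by omega), e, ← Finset.sum_sub_distrib]
  simp only [hw, ← Matrix.sub_mul, ← Finset.sum_sub_distrib, ← Matrix.mul_sub]
  calc _ ≤ ∑ l ∈ Finset.range (n + 1), (∑ k ∈ Finset.range (n + 1), ‖A k‖ * (2 * η)) * ‖A l‖ := by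
        refine norm_sum_le_of_le _ fun l hl => ?_
        rw [Finset.mem_range] at hl
        refine (Matrix.frobenius_norm_mul _ _).trans ?_
        rw [Matrix.frobenius_norm_transpose]
        gcongr
        refine norm_sum_le_of_le _ fun k hk => ?_
        rw [Finset.mem_range] at hk
        refine (Matrix.frobenius_norm_mul _ _).trans ?_
        gcongr
        exact norm_wrapSeq_sub_le hη0 hη (by omega) (by omega) hN
    _ = _ := by rw [← Finset.mul_sum, ← Finset.sum_mul]; ring

theorem norm_toeplZ_coeffSeq_le (A : ℕ → Blk m) (n N : ℕ) :
    ‖toeplZ (coeffSeq A n N) N‖ ≤ m ^ 2 * (∑ k ∈ Finset.range (n + 1), ‖A k‖) * N ^ 2 := by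
  refine norm_le_of_norm_blockAt_le _ fun i j => ?_
  rw [blockAt_toeplZ]
  exact norm_coeffSeq_le A n _

theorem tendsto_pow_mul_pow_half_sub {ρ : ℝ} (h0 : 0 < ρ) (h1 : ρ < 1) (p n : ℕ) :
    Tendsto (fun N : ℕ => (N : ℝ) ^ p * ρ ^ (N / 2 - n)) atTop (𝓝 0) := by
  set σ := √ρ with hσ
  have hσ0 : 0 < σ := Real.sqrt_pos.mpr h0
  have hσ1 : σ < 1 := by
    rw [hσ, Real.sqrt_lt' one_pos]
    simpa using h1
  have hσρ : σ ^ 2 = ρ := Real.sq_sqrt h0.le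
  have hlim := (tendsto_pow_const_mul_const_pow_of_lt_one p hσ0.le hσ1).const_mul
    (σ ^ (2 * n + 1))⁻¹
  rw [mul_zero] at hlim
  refine squeeze_zero (fun N => by positivity) (fun N => ?_) hlim
  -- The exponent 2n + 1 compensates for the shift n and for the rounding in N / 2.
  have : ρ ^ (N / 2 - n) ≤ (σ ^ (2 * n + 1))⁻¹ * σ ^ N := by
    rw [inv_mul_eq_div, le_div_iff₀ (by positivity), ← hσρ, ← pow_mul, ← pow_add]
    exact pow_le_pow_of_le_one hσ0.le hσ1.le (by omega)
  calc _ ≤ (N : ℝ) ^ p * ((σ ^ (2 * n + 1))⁻¹ * σ ^ N) := by gcongr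
    _ = _ := by ring

end Whitening

/-! ### The circulant maximum entropy problem -/

section CME

variable {n m N : ℕ} {S : Fin (n + 1) → Blk m}

theorem IsBlockCirculant.blockAt_add_right [NeZero N] {C : BlockMat N N m}
    (hC : IsBlockCirculant C) (k i j : Fin N) :
    blockAt C (i + k) (j + k) = blockAt C i j := by
  rw [isBlockCirculant_iff] at hC
  obtain ⟨N, rfl⟩ := Nat.exists_eq_succ_of_ne_zero (NeZero.ne N)
  induction k using Fin.induction with
  | zero => simp
  | succ k ih => rw [← Fin.coeSucc_eq_succ, ← add_assoc, ← add_assoc, hC, ih]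

theorem blockU_mul_transpose [NeZero N] : blockU N m * (blockU N m)ᵀ = 1 := by
  refine blockMat_ext fun i j => ?_
  simp [blockU_eq, apply_ite Matrix.transpose, eq_comm]

theorem IsBlockCirculant.inv [NeZero N] {C : BlockMat N N m} (hC : IsBlockCirculant C) :
    IsBlockCirculant C⁻¹ := by
  have h1 : (blockU N m)⁻¹ = (blockU N m)ᵀ := Matrix.inv_eq_right_inv blockU_mul_transpose
  have h2 : (blockU N m)ᵀ⁻¹ = blockU N m := Matrix.inv_eq_left_inv blockU_mul_transpose
  have h3 := congrArg (·⁻¹) hC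
  simp only [Matrix.mul_inv_rev, h1, h2] at h3
  rwa [← Matrix.mul_assoc] at h3

theorem castLE_sub_zero [NeZero N] (hN : n + 1 ≤ N) (k : Fin N) (hk : k.1 ≤ n) :
    Fin.castLE hN ⟨k.1, Nat.lt_succ_of_le hk⟩ = k ∧ Fin.castLE hN 0 = 0 := by
  constructor <;> ext <;> simp

/-- Block-circulant matrices with the same leading principal blocks agree in the circular band. -/
theorem IsBlockCirculant.blockAt_eq_of_corner [NeZero N] (hN : n + 1 ≤ N) {C D : BlockMat N N m}
    (hC : IsBlockCirculant C) (hD : IsBlockCirculant D)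
    (h : ∀ i j : Fin (n + 1), blockAt C (Fin.castLE hN i) (Fin.castLE hN j)
      = blockAt D (Fin.castLE hN i) (Fin.castLE hN j))
    {i j : Fin N} (hij : ¬ (n < (i - j).1 ∧ n < (j - i).1)) : blockAt C i j = blockAt D i j := by
  rcases le_or_gt (i - j).1 n with hk | hk
  · obtain ⟨e1, e2⟩ := castLE_sub_zero hN (i - j) hk
    have h1 := h ⟨(i - j).1, Nat.lt_succ_of_le hk⟩ 0
    rw [e1, e2, ← hC.blockAt_add_right j, ← hD.blockAt_add_right j] at h1
    simpa using h1
  · have hk : (j - i).1 ≤ n := by omega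
    obtain ⟨e1, e2⟩ := castLE_sub_zero hN (j - i) hk
    have h1 := h 0 ⟨(j - i).1, Nat.lt_succ_of_le hk⟩
    rw [e1, e2, ← hC.blockAt_add_right i, ← hD.blockAt_add_right i] at h1
    simpa using h1

theorem trace_eq_of_circulant [NeZero N] (hN : n + 1 ≤ N) {C : BlockMat N N m}
    (hE : (blockE N n m)ᵀ * C * blockE N n m = dataToepl S) (hC : IsBlockCirculant C) :
    C.trace = N * (S 0).trace := by
  have h0 := (blockE_conj_eq_iff hN C _).mp hE 0 0
  have e : Fin.castLE hN 0 = 0 := by ext; simp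
  have h1 (i : Fin N) : blockAt C i i = blockAt C 0 0 := by
    have := hC.blockAt_add_right i 0 0
    rwa [zero_add] at this
  rw [trace_eq_sum_blockAt]
  simp only [h1]
  rw [e] at h0
  rw [h0]
  simp [dataToepl, toepl]

/-- A solution of the circulant problem has a banded inverse. -/
theorem SolvesCME.isBandedBlockCirculant_inv (hN : n + 1 ≤ N) {O : BlockMat N N m}
    (hO : SolvesCME S N O) : IsBandedBlockCirculant n O⁻¹ := by
  have : NeZero N := ⟨by omega⟩
  have hOc := hO.1.2.2
  have hinv := hOc.inv
  -- The out-of-band part of O⁻¹ is a feasible direction: it is symmetric, circulant and zero on the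
  -- data corner.
  set D : BlockMat N N m :=
    ofBlocks fun i j => if n < (i - j).1 ∧ n < (j - i).1 then blockAt O⁻¹ i j else 0 with hD
  have hDs : Dᵀ = D := blockMat_ext fun i j => by
    have := congrArg (fun X => blockAt X i j) hO.1.1.inv.isSymm
    rw [blockAt_transpose] at this
    simp [hD, apply_ite Matrix.transpose, this, and_comm]
  have hDc : IsBlockCirculant D := by
    rw [isBlockCirculant_iff] at hinv ⊢
    intro i j
    simp only [hD, blockAt_ofBlocks, add_sub_add_right_eq_sub, hinv]
  have htr : (O⁻¹ * D).trace = 0 := by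
    refine Matrix.trace_inv_mul_eq_zero_of_forall_det_le hO.1.1 ?_
    filter_upwards [hO.1.1.eventually_add_smul hDs] with t ht
    have hmem : O + t • D ∈ circulantExtensions S N := by
      refine ⟨ht, ?_, ?_⟩
      · rw [blockE_conj_eq_iff hN]
        intro i j
        have e1 := (blockE_conj_eq_iff hN O _).mp hO.1.2.1 i j
        have e2 : blockAt D (Fin.castLE hN i) (Fin.castLE hN j) = 0 := by
          rw [hD, blockAt_ofBlocks, if_neg]
          rintro ⟨h1, h2⟩
          have hi := i.2
          have hj := j.2
          rcases le_total i.1 j.1 with h | h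
          · rw [Fin.sub_val_of_le (show Fin.castLE hN i ≤ Fin.castLE hN j from h)] at h2
            simp only [Fin.val_castLE] at h2
            omega
          · rw [Fin.sub_val_of_le (show Fin.castLE hN j ≤ Fin.castLE hN i from h)] at h1
            simp only [Fin.val_castLE] at h1
            omega
        rw [blockAt_add, blockAt_smul, e1, e2, smul_zero, add_zero]
      · rw [isBlockCirculant_iff] at hOc hDc ⊢
        intro i j
        rw [blockAt_add, blockAt_smul, hOc, hDc, blockAt_add, blockAt_smul]
    exact (Real.log_le_log_iff ht.det_pos hO.1.1.det_pos).mp (hO.2 hmem)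
  have hD0 : D = 0 := by
    -- O⁻¹ - D and D have complementary supports, so stationarity tr(O⁻¹ D) = 0 becomes ‖D‖² = 0.
    have h1 : ((O⁻¹ - D) * D).trace = 0 := by
      refine trace_mul_eq_zero_of_blockAt fun i j => ?_
      by_cases h : n < (i - j).1 ∧ n < (j - i).1
      · left
        rw [blockAt_sub, hD, blockAt_ofBlocks, if_pos h, sub_self]
      · right
        rw [hD, blockAt_ofBlocks, if_neg (by rwa [and_comm])]
    rw [Matrix.sub_mul, Matrix.trace_sub, htr, zero_sub, neg_eq_zero] at h1
    have h2 := Matrix.frobenius_norm_sq_eq_trace D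
    rw [hDs, h1] at h2
    exact norm_eq_zero.mp (pow_eq_zero_iff two_ne_zero |>.mp h2)
  refine ⟨hinv, fun i j h1 h2 => ?_⟩
  have := congrArg (fun X => blockAt X i j) hD0
  simp only [hD, blockAt_ofBlocks, if_pos (And.intro h1 h2)] at this
  exact this

theorem SolvesCME.trace_sub_mul_inv_sub_eq_zero (hN : n + 1 ≤ N) {O W B : BlockMat N N m}
    (hO : SolvesCME S N O) (hW : W ∈ circulantExtensions S N)
    (hB : ∀ i j : Fin N, n < (i - j).1 → n < (j - i).1 → blockAt B i j = 0) :
    ((W - O) * (O⁻¹ - B)).trace = 0 := by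
  have : NeZero N := ⟨by omega⟩
  refine trace_mul_eq_zero_of_blockAt fun i j => ?_
  by_cases h : n < (i - j).1 ∧ n < (j - i).1
  · right
    rw [blockAt_sub, hB j i h.2 h.1, (hO.isBandedBlockCirculant_inv hN).2 j i h.2 h.1, sub_self]
  · left
    rw [blockAt_sub, hW.2.2.blockAt_eq_of_corner hN hO.1.2.2 _ h, sub_self]
    intro i j
    rw [(blockE_conj_eq_iff hN W _).mp hW.2.1, (blockE_conj_eq_iff hN O _).mp hO.1.2.1]

theorem SolvesCME.unique (hN : n + 1 ≤ N) {O O' : BlockMat N N m} (hO : SolvesCME S N O)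
    (hO' : SolvesCME S N O') : O' = O :=
  hO'.1.1.eq_of_trace_sub_mul_inv_sub_eq_zero hO.1.1
    (hO.trace_sub_mul_inv_sub_eq_zero hN hO'.1 (hO'.isBandedBlockCirculant_inv hN).2)

/-- A circulant extension whose inverse is almost banded is close to the optimal one. -/
theorem SolvesCME.norm_sub_le (hN : n + 1 ≤ N) {O W B : BlockMat N N m} (hO : SolvesCME S N O)
    (hW : W ∈ circulantExtensions S N)
    (hB : ∀ i j : Fin N, n < (i - j).1 → n < (j - i).1 → blockAt B i j = 0) {δ : ℝ}
    (hδ : ‖W⁻¹ - B‖ ≤ δ) : ‖W - O‖ ≤ (N * (S 0).trace) ^ 2 * δ := by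
  have : NeZero N := ⟨by omega⟩
  have h1 := hW.1.norm_sub_sq_le hO.1.1
  rw [trace_eq_of_circulant hN hW.2.1 hW.2.2, trace_eq_of_circulant hN hO.1.2.1 hO.1.2.2] at h1
  have h2 : ((W - O) * (O⁻¹ - W⁻¹)).trace = ((W - O) * (B - W⁻¹)).trace := by
    rw [← sub_add_sub_cancel O⁻¹ B W⁻¹, Matrix.mul_add, Matrix.trace_add,
      hO.trace_sub_mul_inv_sub_eq_zero hN hW hB, zero_add]
  have h3 : ((W - O) * (B - W⁻¹)).trace ≤ ‖W - O‖ * δ := by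
    refine (le_abs_self _).trans ((Matrix.abs_trace_mul_le _ _).trans ?_)
    rw [norm_sub_rev B]
    gcongr
  rw [h2] at h1
  -- One factor ‖W - O‖ is then cancelled, the case where it is zero being trivial.
  have h4 : ‖W - O‖ ^ 2 ≤ (N * (S 0).trace) ^ 2 * δ * ‖W - O‖ := by
    refine h1.trans ?_
    rw [← sq, mul_assoc, mul_comm δ]
    gcongr
  rcases (norm_nonneg (W - O)).eq_or_lt with h | h
  · rw [← h]
    have : 0 ≤ δ := (norm_nonneg _).trans hδ
    positivity
  · rw [sq] at h4
    exact le_of_mul_le_mul_right h4 h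

/-! ### Existence of a circulant optimum by compactness -/

theorem isCompact_setOf_abs_le {ι κ : Type*} (R : ℝ) :
    IsCompact {C : Matrix ι κ ℝ | ∀ i j, |C i j| ≤ R} := by
  have h : IsCompact (Set.univ.pi fun _ : ι => Set.univ.pi fun _ : κ => Set.Icc (-R) R) :=
    isCompact_univ_pi fun _ => isCompact_univ_pi fun _ => isCompact_Icc
  have e : {C : Matrix ι κ ℝ | ∀ i j, |C i j| ≤ R}
      = (Set.univ.pi fun _ : ι => Set.univ.pi fun _ : κ => Set.Icc (-R) R) := by
    ext C
    exact ⟨fun hC i _ j _ => abs_le.mp (hC i j), fun hC i j => abs_le.mpr (hC i trivial j trivial)⟩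
  rw [e]
  exact h

theorem isClosed_setOf_posSemidef {ι : Type*} [Fintype ι] [DecidableEq ι] :
    IsClosed {C : Matrix ι ι ℝ | C.PosSemidef} := by
  simp only [Matrix.posSemidef_iff_dotProduct_mulVec, Set.ofPred_and, Set.ofPred_forall]
  refine IsClosed.inter ?_ (isClosed_iInter fun x => ?_)
  · exact isClosed_eq (by fun_prop) continuous_id
  · exact isClosed_le continuous_const (by fun_prop)

/-- The data and circulance fix the trace, which bounds all entries of a positive semidefinite
matrix. Requiring det C ≥ det W gives a compact set without singular matrices and loses no better
competitor. -/
theorem exists_solvesCME (hN : n + 1 ≤ N) {W : BlockMat N N m}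
    (hW : W ∈ circulantExtensions S N) : ∃ O, SolvesCME S N O := by
  have : NeZero N := ⟨by omega⟩
  set K : Set (BlockMat N N m) := {C | C.PosSemidef ∧
    (blockE N n m)ᵀ * C * blockE N n m = dataToepl S ∧ (blockU N m)ᵀ * C * blockU N m = C ∧
    W.det ≤ C.det} with hK
  have hclosed : IsClosed K := by
    have hE : Continuous fun C : BlockMat N N m => (blockE N n m)ᵀ * C * blockE N n m := by fun_prop
    have hU : Continuous fun C : BlockMat N N m => (blockU N m)ᵀ * C * blockU N m := by fun_prop
    have hdet : Continuous fun C : BlockMat N N m => C.det := by fun_prop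
    exact isClosed_setOf_posSemidef.inter ((isClosed_eq hE continuous_const).inter
      ((isClosed_eq hU continuous_id).inter (isClosed_le continuous_const hdet)))
  have hcompact : IsCompact K := by
    refine (isCompact_setOf_abs_le (N * (S 0).trace)).of_isClosed_subset hclosed ?_
    intro C hC i j
    rw [← trace_eq_of_circulant hN hC.2.1 hC.2.2.1]
    exact (Matrix.abs_entry_le_frobenius C i j).trans hC.1.frobenius_le_trace
  obtain ⟨O, hO, hmax⟩ := hcompact.exists_isMaxOn ⟨W, hW.1.posSemidef, hW.2.1, hW.2.2, le_rfl⟩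
    (f := fun C => C.det) (by fun_prop)
  have hpd : O.PosDef :=
    hO.1.posDef_iff_det_ne_zero.mpr (hW.1.det_pos.trans_le hO.2.2.2).ne'
  refine ⟨O, ⟨hpd, hO.2.1, hO.2.2.1⟩, fun X hX => Real.log_le_log hX.1.det_pos ?_⟩
  rcases le_total W.det X.det with h | h
  · exact hmax ⟨hX.1.posSemidef, hX.2.1, hX.2.2, h⟩
  · exact h.trans hO.2.2.2

end CME

/-! ### Asymptotics of the wrapped matrices -/

section Asymptotics

variable {n m : ℕ} {S : Fin (n + 1) → Blk m} {A : ℕ → Blk m} {Λ : Blk m} {s : ℕ → Blk m}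

/-- The wrapped matrices are eventually circulant extensions of the data, and their inverses are
approximated by banded matrices with an error that decays exponentially. -/
theorem IsAutoregressive.exists_wrapped_bounds (h : IsAutoregressive n A Λ (symmExt s))
    (hT : (dataToepl S).PosDef) (hs0 : (s 0)ᵀ = s 0) (hs : ∀ k : Fin (n + 1), s k = S k) :
    ∃ a b ρ : ℝ, 0 < ρ ∧ ρ < 1 ∧ ∀ᶠ N : ℕ in atTop, wrapped s N ∈ circulantExtensions S N ∧
      ‖(wrapped s N)⁻¹‖ ≤ a * N ^ 5 ∧ ∃ B : BlockMat N N m,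
        (∀ i j : Fin N, n < (i - j).1 → n < (j - i).1 → blockAt B i j = 0) ∧
        ‖(wrapped s N)⁻¹ - B‖ ≤ b * (N ^ 8 * ρ ^ (N / 2 - n)) := by
  obtain ⟨C, ρ, hC, hρ0, hρ1, hG⟩ := h.exists_geometric_bound
  set α := ∑ k ∈ Finset.range (n + 1), ‖A k‖
  set τ := Λ⁻¹.trace
  have hlim := (tendsto_pow_mul_pow_half_sub hρ0 hρ1 3 n).const_mul
    (τ * (m ^ 2 * (α ^ 2 * (2 * C))))
  rw [mul_zero] at hlim
  -- In `of_congruence_near`, `lam` is of order N², c = N τ, and ε is of order N² ρ^(N/2 - n). Hence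
  -- the powers N³ for c ε, N⁵ for the inverse and N⁸ for its distance to B.
  refine ⟨(m ^ 2 * α) ^ 2 * (2 * τ),
    (m ^ 2 * α) ^ 2 * (2 * τ ^ 2 * (m ^ 2 * (α ^ 2 * (2 * C)))), ρ, hρ0, hρ1, ?_⟩
  filter_upwards [hlim.eventually_le_const (show (0 : ℝ) < 1 / 2 by norm_num),
    eventually_gt_atTop (2 * n)] with N hN hnN
  have : NeZero N := ⟨by omega⟩
  have hη (z : ℤ) (hz : N / 2 - n ≤ z.natAbs) : ‖symmExt s z‖ ≤ C * ρ ^ (N / 2 - n) :=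
    (hG z).trans (mul_le_mul_of_nonneg_left (pow_le_pow_of_le_one hρ0.le hρ1.le hz) hC)
  rw [wrapped_eq_toeplZ hs0]
  have hsymm : (toeplZ (wrapSeq (symmExt s) N) N)ᵀ = toeplZ (wrapSeq (symmExt s) N) N :=
    blockMat_ext fun i j => by
      rw [blockAt_transpose, blockAt_toeplZ, blockAt_toeplZ,
        wrapSeq_transpose h.transpose (by omega) (by omega), neg_sub]
  have hinv := blockScalar_inv (N := N) h.innovation_posDef.isUnit_det
  obtain ⟨h1, h2, h3⟩ := (posDef_blockScalar (N := N) h.innovation_posDef).of_congruence_near hsymm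
    (norm_toeplZ_coeffSeq_le A n N) (c := N * τ) (by rw [hinv, trace_blockScalar])
    (h.norm_whitened_sub_le (by positivity) hη hnN) (le_of_eq_of_le (by ring) hN)
  refine ⟨⟨h1, ?_, isBlockCirculant_toeplZ (wrapSeq_congr _)⟩, h3.trans_eq (by ring), _, ?_,
    h2.trans_eq (by ring)⟩
  · rw [blockE_conj_eq_iff (by omega), dataToepl_eq_toeplZ hT hs]
    intro i j
    rw [blockAt_toeplZ, blockAt_toeplZ, Fin.val_castLE, Fin.val_castLE,
      wrapSeq_of_small _ (by omega) (by omega)]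
  · intro i j hij hji
    rw [hinv]
    exact blockAt_whitening_eq_zero A Λ⁻¹ hij hji

end Asymptotics

theorem theorem1 (m n : ℕ) (S : Fin (n + 1) → Blk m) (hT : (dataToepl S).PosDef) :
    (∃! Shat : ℕ → Blk m, IsMaxEntToeplitzExtension S Shat) ∧
    ∀ Shat : ℕ → Blk m, IsMaxEntToeplitzExtension S Shat →
      (∀ᶠ N : ℕ in atTop,
        (wrapped Shat N).PosDef ∧ IsBlockCirculant (wrapped Shat N) ∧
          (blockE N n m)ᵀ * wrapped Shat N * blockE N n m = dataToepl S) ∧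
      (∀ᶠ N : ℕ in atTop, ∃! C : BlockMat N N m, SolvesCME S N C) ∧
      ∀ Sopt : (N : ℕ) → BlockMat N N m, (∀ᶠ N : ℕ in atTop, SolvesCME S N (Sopt N)) →
        (∀ᶠ N : ℕ in atTop, IsBandedBlockCirculant n (Sopt N)⁻¹) ∧
        Tendsto (fun N : ℕ => ‖wrapped Shat N - Sopt N‖) atTop (𝓝 0) ∧
        Tendsto (fun N : ℕ => ‖(wrapped Shat N)⁻¹ - (Sopt N)⁻¹‖) atTop (𝓝 0) := by
  obtain ⟨A, Λ, s, hs, hs0, h⟩ := exists_isAutoregressive hT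
  have huniq := fun s' => h.eq_of_isMaxEntToeplitzExtension hT hs0 hs (s' := s')
  refine ⟨⟨s, h.isMaxEntToeplitzExtension hT hs0 hs, huniq⟩, fun Shat hShat => ?_⟩
  obtain rfl := huniq Shat hShat
  obtain ⟨a, b, ρ, hρ0, hρ1, hW⟩ := h.exists_wrapped_bounds hT hs0 hs
  have hN := eventually_ge_atTop (n + 1)
  refine ⟨hW.mono fun N hN => ⟨hN.1.1, hN.1.2.2, hN.1.2.1⟩, ?_, fun Sopt hSopt => ?_⟩
  · filter_upwards [hW, hN] with N hW hN
    obtain ⟨O, hO⟩ := exists_solvesCME hN hW.1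
    exact ⟨O, hO, fun O' hO' => hO.unique hN hO'⟩
  -- The power 10 is the 8 from the approximation of the inverse plus 2 from the squared trace.
  have hD : ∀ᶠ N : ℕ in atTop, ‖wrapped Shat N - Sopt N‖
      ≤ (S 0).trace ^ 2 * b * (N ^ 10 * ρ ^ (N / 2 - n)) := by
    filter_upwards [hW, hSopt, hN] with N hW hO hN
    obtain ⟨hW, -, B, hB, hδ⟩ := hW
    exact (hO.norm_sub_le hN hW hB hδ).trans_eq (by ring)
  have hlim (p : ℕ) (c : ℝ) : Tendsto (fun N : ℕ => c * ((N : ℝ) ^ p * ρ ^ (N / 2 - n)))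
      atTop (𝓝 0) := by
    simpa using (tendsto_pow_mul_pow_half_sub hρ0 hρ1 p n).const_mul c
  refine ⟨?_, squeeze_zero' (.of_forall fun _ => norm_nonneg _) hD (hlim 10 _),
    squeeze_zero' (.of_forall fun _ => norm_nonneg _) ?_
      (hlim 20 (2 * a ^ 2 * ((S 0).trace ^ 2 * b)))⟩
  · filter_upwards [hSopt, hN] with N hO hN
    exact hO.isBandedBlockCirculant_inv hN
  -- With ‖W⁻¹‖ of order N⁵, the smallness condition of the resolvent estimate costs N^(5+10), and
  -- its conclusion N^(2·5+10).
  · filter_upwards [hW, hSopt, hD, (hlim 15 (a * ((S 0).trace ^ 2 * b))).eventually_le_const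
      (show (0 : ℝ) < 1 / 2 by norm_num)] with N hW hO hD hsmall
    have h0 : 0 ≤ a * N ^ 5 := (norm_nonneg _).trans hW.2.1
    rw [norm_sub_rev] at hD ⊢
    have := Matrix.norm_inv_sub_inv_le hW.1.1.isUnit_det hO.1.1.isUnit_det hW.2.1
      ((mul_le_mul_of_nonneg_left hD h0).trans (le_of_eq_of_le (by ring) hsmall))
    calc _ ≤ 2 * (a * N ^ 5) ^ 2 * ‖Sopt N - wrapped Shat N‖ := this
      _ ≤ 2 * (a * N ^ 5) ^ 2 * ((S 0).trace ^ 2 * b * (N ^ 10 * ρ ^ (N / 2 - n))) := by gcongr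
      _ = _ := by ring
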